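/- **Definitions.** All structures are finite. A $2$-$(v,k,1)$ design is a set of $v$ points with a set of $k$-subsets called lines such that any two distinct points lie on exactly one line. A *Sperner space* with parameters $(v,k)$ is a $2$-$(v,k,1)$ design together with a parallelism, i.e. a partition of the lines into (parallel) classes each of which partitions the point set. An isomorphism of Sperner spaces is a bijection between the point sets mapping lines to lines and parallel classes to parallel classes (in both directions). An $(n-1)$-spread $\mathcal S$ of $\mathrm{PG}(d-1,q)$ is a set of $n$-dimensional subspaces of $V=\mathbb F_q^{d}$ such that every non-zero vector lies in exactly one of them. Its Sperner space $\mathcal T(\mathcal S)$ has as points the vectors of $V$, as lines the cosets of the elements of $\mathcal S$, and as parallel classes the sets of all cosets of one element. A *translation Sperner space* is a Sperner space isomorphic to some $\mathcal T(\mathcal S)$. $\mathrm{AG}(r,Q)$ is the affine space $\mathbb F_Q^{\,r}$, with the cosets of one-dimensional subspaces as lines and the usual parallelism. Let $\mathcal T$ be a Sperner space. The *linear manifold* $\mathcal M(X)$ of a set $X$ of points is the smallest set of points containing $X$ and, with any two of its points, all points of the line joining them; for a set $N$ of lines, $\mathcal M(N)$ is the linear manifold of the union of the lines in $N$. A *pseudo-plane*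 is the linear manifold of three non-collinear points. A set $M$ of points of $\mathcal T$ is an *affine plane* of $\mathcal T$ if $M$, with the lines of $\mathcal T$ contained in $M$ and the parallelism induced by $\mathcal T$, is a Sperner space with parameters $(m^2,m)$ for some $m\ge 2$. It is an *affine semifield plane* if moreover its points and lines form a plane isomorphic to the one with point set $Q\times Q$ and lines $x=c$ and $y=x*m+b$ ($b,c,m\in Q$) for some finite semifield $(Q,+,*)$ (with identity, not necessarily associative). A line $\ell$ is *normal* if for every point $x\notin \ell$ the pseudo-plane $\mathcal M(\ell\cup\{x\})$ is an affine plane of $\mathcal T$. For a given integer $r$, a set $N$ of normal lines through a common point $P$ is *in general position* if $\ell\cap\mathcal M(N')=\{P\}$ for every $\ell\in N$ and every non-empty $N'\subseteq N\setminus\{\ell\}$ with $|N'|\le r-1$. **Statement.** Let $q$ be a prime power, $n\ge 1$, $r>2$, and let $\mathcal T$ be a translation Sperner space with parameters $(q^{rn},q^n)$. 1. If $\mathcal T$ contains $r+1$ normal lines through a common point in general position, then $\mathcal T$ is isomorphic to $\mathrm{AG}(r,q^n)$. 2. Suppose $r=3$ and $q$ is odd. (a) If $\mathcal T$ contains three distinct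 normal lines through a common point which are contained in an affine plane of $\mathcal T$, then every pseudo-plane of $\mathcal T$ containing exactly one of these three lines is an affine semifield plane. (b) If $\mathcal T$ contains four distinct normal lines through a common point which are not all contained in a common affine plane of $\mathcal T$, then $\mathcal T$ is isomorphic to $\mathrm{AG}(3,q^n)$. 3. Suppose $q$ is odd. If $\mathcal T$ contains a set of at least $r+1$ normal lines through a common point such that the linear manifold of some $r$ of them is all of $\mathcal T$, then $\mathcal T$ is isomorphic to $\mathrm{AG}(r,q^n)$. -/

import Mathlib

/-! Finite designs, Sperner spaces, spreads, translation Sperner spaces, normal lines. -/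

/-- The blocks `B`, subsets of the finite point set `X`, form a `2-(v,k,1)` design. -/
def IsDesign {P : Type*} (X : Set P) (B : Set (Set P)) (v k : ℕ) : Prop :=
  X.Finite ∧ X.ncard = v ∧ (∀ b ∈ B, b ⊆ X ∧ b.ncard = k) ∧
    ∀ x ∈ X, ∀ y ∈ X, x ≠ y → ∃! b, b ∈ B ∧ x ∈ b ∧ y ∈ b

/-- `C` is a parallelism: a partition of the set `B` of blocks into classes, each of which
partitions the point set `X`. -/
def IsParallelism {P : Type*} (X : Set P) (B : Set (Set P)) (C : Set (Set (Set P))) : Prop :=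
  (∀ c ∈ C, c ⊆ B) ∧ (∀ b ∈ B, ∃! c, c ∈ C ∧ b ∈ c) ∧ ∀ c ∈ C, ∀ x ∈ X, ∃! b, b ∈ c ∧ x ∈ b

/-- A Sperner space with parameters `(v,k)` on the point set `P`: a `2-(v,k,1)` design together
with a parallelism. -/
structure SpernerSpace (P : Type*) (v k : ℕ) where
  lines : Set (Set P)
  classes : Set (Set (Set P))
  isDesign : IsDesign Set.univ lines v k
  isParallelism : IsParallelism Set.univ lines classes

namespace SpernerSpace

variable {P P' : Type*} {v k v' k' : ℕ}

/-- Isomorphism of Sperner spaces: a bijection of the points that maps lines to lines and parallel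
classes to parallel classes, in both directions. -/
def Isomorphic (T : SpernerSpace P v k) (T' : SpernerSpace P' v' k') : Prop :=
  ∃ f : P ≃ P', (∀ l : Set P, l ∈ T.lines ↔ f '' l ∈ T'.lines) ∧
    ∀ c : Set (Set P), c ∈ T.classes ↔ (fun l : Set P => f '' l) '' c ∈ T'.classes

/-- `M` contains, with any two distinct points, all points of the line joining them. -/
def IsLineClosed (T : SpernerSpace P v k) (M : Set P) : Prop :=
  ∀ x ∈ M, ∀ y ∈ M, x ≠ y → ∀ l ∈ T.lines, x ∈ l → y ∈ l → l ⊆ M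

/-- The (point set of the) linear manifold of a set `X` of points: the smallest line-closed set
containing `X`. -/
def manifold (T : SpernerSpace P v k) (X : Set P) : Set P :=
  ⋂₀ {M | X ⊆ M ∧ T.IsLineClosed M}

/-- The lines of the structure induced on `M`: the lines contained in `M`. -/
def inducedLines (T : SpernerSpace P v k) (M : Set P) : Set (Set P) :=
  {l | l ∈ T.lines ∧ l ⊆ M}

/-- The parallel classes induced on `M`: the non-empty traces of the parallel classes. -/
def inducedClasses (T : SpernerSpace P v k) (M : Set P) : Set (Set (Set P)) :=
  {d | d.Nonempty ∧ ∃ c ∈ T.classes, d = {l | l ∈ c ∧ l ⊆ M}}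

/-- The structure induced on `M` is an affine plane, that is, a Sperner space with parameters
`(m ^ 2, m)` for some order `m ≥ 2` (lines and parallelism being those of `T`). -/
def IsAffinePlane (T : SpernerSpace P v k) (M : Set P) : Prop :=
  ∃ m : ℕ, 2 ≤ m ∧ IsDesign M (T.inducedLines M) (m ^ 2) m ∧
    IsParallelism M (T.inducedLines M) (T.inducedClasses M)

/-- A pseudo-plane: the linear manifold of three non-collinear points. -/
def IsPseudoPlane (T : SpernerSpace P v k) (M : Set P) : Prop :=
  ∃ x y z : P, (¬ ∃ l ∈ T.lines, x ∈ l ∧ y ∈ l ∧ z ∈ l) ∧ M = T.manifold {x, y, z}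

/-- A line is normal if every pseudo-plane defined by it and a point off it is an affine plane. -/
def IsNormalLine (T : SpernerSpace P v k) (l : Set P) : Prop :=
  l ∈ T.lines ∧ ∀ x, x ∉ l → T.IsAffinePlane (T.manifold (insert x l))

/-- `N` is a set of normal lines through the point `p`. -/
def AreNormalLinesThrough (T : SpernerSpace P v k) (p : P) (N : Set (Set P)) : Prop :=
  ∀ l ∈ N, T.IsNormalLine l ∧ p ∈ l

/-- General position (with respect to the dimension `r`) of a set `N` of lines through `p`: each
of them meets the linear manifold of at most `r - 1` (and at least one) others only in `p`. -/
def InGeneralPosition (T : SpernerSpace P v k) (r : ℕ) (p : P) (N : Set (Set P)) : Prop :=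
  ∀ l ∈ N, ∀ N' : Set (Set P), N' ⊆ N \ {l} → N'.Finite → N'.Nonempty → N'.ncard ≤ r - 1 →
    l ∩ T.manifold (⋃₀ N') = {p}

end SpernerSpace

/-- An `(n-1)`-spread of the projective space of the `K`-vector space `V`: a set of
`n`-dimensional subspaces of `V` containing every non-zero vector exactly once. -/
structure ProjSpread (K V : Type*) [Field K] [AddCommGroup V] [Module K V] (n : ℕ) where
  elements : Set (Submodule K V)
  finrank_eq : ∀ W ∈ elements, Module.finrank K W = n
  existsUnique_mem : ∀ x : V, x ≠ 0 → ∃! W, W ∈ elements ∧ x ∈ W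

/-- The coset `a + W`: the affine points of the projective subspace through the affine point `a`
that meets the hyperplane at infinity in `W`. -/
def affineCoset {K V : Type*} [Field K] [AddCommGroup V] [Module K V]
    (W : Submodule K V) (a : V) : Set V :=
  {x | x - a ∈ W}

section cosets

variable {K V : Type*} [Field K] [AddCommGroup V] [Module K V]

theorem mem_affineCoset_self (W : Submodule K V) (a : V) : a ∈ affineCoset W a := by
  simp [affineCoset]

theorem affineCoset_eq_of_mem {W : Submodule K V} {a b : V} (h : b ∈ affineCoset W a) :
    affineCoset W a = affineCoset W b := by
  ext x
  have h' : b - a ∈ W := h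
  constructor
  · intro hx
    have := W.sub_mem (show x - a ∈ W from hx) h'
    simpa [affineCoset] using this
  · intro hx
    have := W.add_mem (show x - b ∈ W from hx) h'
    simpa [affineCoset] using this

theorem submodule_eq_of_affineCoset_eq {W W' : Submodule K V} {a b : V}
    (h : affineCoset W a = affineCoset W' b) : W = W' := by
  have hb : a ∈ affineCoset W' b := h ▸ mem_affineCoset_self W a
  rw [affineCoset_eq_of_mem hb] at h
  ext x
  have := Set.ext_iff.1 h (x + a)
  simpa [affineCoset] using this

theorem ncard_affineCoset (W : Submodule K V) (a : V) :
    (affineCoset W a).ncard = Nat.card W := by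
  have : affineCoset W a = (fun x => x + a) '' (W : Set V) := by
    ext x
    constructor
    · intro hx
      exact ⟨x - a, hx, by simp⟩
    · rintro ⟨y, hy, rfl⟩
      simpa [affineCoset] using hy
  rw [this, Set.ncard_image_of_injective _ (add_left_injective a)]
  rfl

end cosets

/-- The translation Sperner space `T(S)` of a spread `S`: its points are the affine points, i.e.
the vectors of `V`; its lines are the cosets of the elements of `S`; its parallel classes are the
sets of all cosets of one element of `S`. -/
def ProjSpread.toSperner {K V : Type*} [Field K] [AddCommGroup V] [Module K V] [Finite K]
    [Finite V] {n : ℕ} (S : ProjSpread K V n) : SpernerSpace V (Nat.card V) (Nat.card K ^ n) where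
  lines := {l | ∃ W ∈ S.elements, ∃ a, l = affineCoset W a}
  classes := {c | ∃ W ∈ S.elements, c = {l | ∃ a, l = affineCoset W a}}
  isDesign := by
    refine ⟨Set.toFinite _, Set.ncard_univ V, ?_, ?_⟩
    · rintro _ ⟨W, hW, a, rfl⟩
      refine ⟨Set.subset_univ _, ?_⟩
      rw [ncard_affineCoset, Module.natCard_eq_pow_finrank (K := K), S.finrank_eq W hW]
    · intro x _ y _ hxy
      obtain ⟨W, ⟨hW, hm⟩, hu⟩ := S.existsUnique_mem (y - x) (sub_ne_zero.2 hxy.symm)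
      refine ⟨affineCoset W x, ⟨⟨W, hW, x, rfl⟩, mem_affineCoset_self W x, hm⟩, ?_⟩
      rintro _ ⟨⟨W', hW', a, rfl⟩, hx, hy⟩
      rw [affineCoset_eq_of_mem hx] at hy ⊢
      rw [hu W' ⟨hW', hy⟩]
  isParallelism := by
    refine ⟨?_, ?_, ?_⟩
    · rintro _ ⟨W, hW, rfl⟩ _ ⟨a, rfl⟩
      exact ⟨W, hW, a, rfl⟩
    · rintro _ ⟨W, hW, a, rfl⟩
      refine ⟨_, ⟨⟨W, hW, rfl⟩, a, rfl⟩, ?_⟩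
      rintro _ ⟨⟨W', _, rfl⟩, b, hb⟩
      rw [submodule_eq_of_affineCoset_eq hb]
    · rintro _ ⟨W, hW, rfl⟩ x _
      refine ⟨affineCoset W x, ⟨⟨x, rfl⟩, mem_affineCoset_self W x⟩, ?_⟩
      rintro _ ⟨⟨a, rfl⟩, hx⟩
      exact affineCoset_eq_of_mem hx

/-- The spread of all one-dimensional subspaces. -/
def pointSpread (F V : Type*) [Field F] [AddCommGroup V] [Module F V] : ProjSpread F V 1 where
  elements := {W | Module.finrank F W = 1}
  finrank_eq := fun _ h => h
  existsUnique_mem := by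
    intro x hx
    refine ⟨Submodule.span F {x}, ⟨finrank_span_singleton hx, Submodule.mem_span_singleton_self x⟩,
      ?_⟩
    rintro W ⟨hW, hxW⟩
    have hW' : Module.finrank F W = 1 := hW
    have : FiniteDimensional F W := Module.finite_of_finrank_eq_succ hW'
    exact (Submodule.eq_of_le_of_finrank_eq ((Submodule.span_singleton_le_iff_mem x W).2 hxW)
      ((finrank_span_singleton hx).trans hW'.symm)).symm

/-- The affine space `AG(r, F)`: the points are the vectors of `F ^ r`, the lines are the cosets
of the one-dimensional subspaces, with the usual parallelism. -/
def affineSpace (r : ℕ) (F : Type*) [Field F] [Finite F] :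
    SpernerSpace (Fin r → F) (Nat.card (Fin r → F)) (Nat.card F ^ 1) :=
  (pointSpread F (Fin r → F)).toSperner

/-- A (finite) semifield: a not necessarily associative unital ring whose non-zero elements form a
multiplicative loop. -/
def IsSemifield (Q : Type*) [NonAssocRing Q] : Prop :=
  Finite Q ∧ Nontrivial Q ∧
    ∀ a b : Q, a ≠ 0 → (∃! x, a * x = b) ∧ ∃! y, y * a = b

/-- The lines of the affine plane coordinatised by `Q`: `x = c` and `y = x * m + b`. -/
def coordinateLines (Q : Type*) [NonAssocRing Q] : Set (Set (Q × Q)) :=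
  {l | (∃ c : Q, l = {z | z.1 = c}) ∨ ∃ m b : Q, l = {z | z.2 = z.1 * m + b}}

namespace SpernerSpace

variable {P : Type*} {v k : ℕ}

/-- Translation Sperner spaces: those arising from a spread of a finite projective space. -/
def IsTranslation (T : SpernerSpace P v k) : Prop :=
  ∃ (K : Type) (_ : Field K) (_ : Finite K) (d n : ℕ) (S : ProjSpread K (Fin d → K) n),
    T.Isomorphic S.toSperner

/-- `T` is isomorphic to the affine space `AG(r, Q)` over the field with `Q` elements. -/
def IsIsomorphicToAG (T : SpernerSpace P v k) (r Q : ℕ) : Prop :=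
  ∃ (F : Type) (_ : Field F) (_ : Finite F), Nat.card F = Q ∧ T.Isomorphic (affineSpace r F)

/-- The structure induced on `M` is (isomorphic to) the affine plane over a semifield. -/
def IsAffineSemifieldPlane (T : SpernerSpace P v k) (M : Set P) : Prop :=
  T.IsAffinePlane M ∧
    ∃ (Q : Type) (_ : NonAssocRing Q), IsSemifield Q ∧
      ∃ f : Q × Q → P, Function.Injective f ∧ Set.range f = M ∧
        ∀ l : Set (Q × Q), l ∈ coordinateLines Q ↔ f '' l ∈ T.lines

end SpernerSpace

/-! With the common point taken as zero, a translation Sperner space is an abelian group partitioned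
into subgroups of order `k = q ^ n`; `L v` is the member through `v`, and lines are cosets of
members. An affine plane through zero is closed under joins and parallels, hence a subgroup. So a
normal line through zero is a member `L c` for which every `L c ⊔ L v` is a union of members
(`exists_of_isNormalLine`).

The conclusions about `AG` all need a frame of `r` normal directions, with members summing directly
to the whole group, and one further normal direction `c`. Normality makes the coordinate projections
of the frame preserve the partition (`sum_summandProj_mem`). A member with all coordinates nonzero,
chosen to agree with `c` wherever `c` is nonzero, identifies every summand with one group `A` and
serves as the diagonal. Since there are at least three coordinates, the relation that members induce
on pairs of coordinates does not depend on the pair, and it can be composed. The members thus have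
slopes: endomorphisms of `A`, closed under composition, exactly one of which sends a given `a ≠ 0`
to a given `b`. As `c` is constant on a set of at least two coordinates and zero elsewhere, its
normality closes the slopes under subtraction (`sub_mem_graphs`). They form a finite ring without
zero divisors, a field by Wedderburn's theorem, and the members are its one-dimensional subspaces
(`exists_field`).

For the semifield planes, let `a`, `b`, `c` be normal directions in one plane and `d` a direction
outside it. In `L a ⊔ L d` the member through `d + α` is the graph of `δ ↦ μ δ α`. Additivity in `δ`
is automatic; additivity in `α` follows by comparing shears along `a` and `b` modulo `L c`
(`exists_additive`). A biadditive `μ` without zero divisors is a semifield multiplication once `L d`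
is identified with `L a`. Odd order ensures that an arbitrary pseudo-plane through zero is a
subgroup, hence of the form `L a ⊔ L d`. -/

/-! ### Translation Sperner spaces as partitioned abelian groups -/

/-- A partition of the nonzero elements of an abelian group by subgroups of order `Q`, given by the
map that sends each nonzero `v` to the member of the partition containing it, and `0` to `⊥`. -/
structure IsSpreadMap {V : Type*} [AddCommGroup V] (L : V → AddSubgroup V) (Q : ℕ) : Prop where
  zero : L 0 = ⊥
  self_mem : ∀ v, v ∈ L v
  eq_of_mem : ∀ {v w}, w ∈ L v → w ≠ 0 → L w = L v
  card : ∀ v, v ≠ 0 → Nat.card (L v) = Q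

namespace IsSpreadMap

variable {V : Type*} [AddCommGroup V] {L : V → AddSubgroup V} {Q : ℕ}

theorem eq_of_mem_of_mem (hL : IsSpreadMap L Q) {v w x : V} (hv : x ∈ L v) (hw : x ∈ L w)
    (hx : x ≠ 0) : L v = L w :=
  (hL.eq_of_mem hv hx).symm.trans (hL.eq_of_mem hw hx)

theorem mem_symm (hL : IsSpreadMap L Q) {v w : V} (h : w ∈ L v) (hw : w ≠ 0) : v ∈ L w :=
  hL.eq_of_mem h hw ▸ hL.self_mem v

theorem eq_zero_of_mem_zero (hL : IsSpreadMap L Q) {w : V} (h : w ∈ L 0) : w = 0 := by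
  rwa [hL.zero, AddSubgroup.mem_bot] at h

theorem le_of_mem (hL : IsSpreadMap L Q) {v w : V} (h : w ∈ L v) : L w ≤ L v := by
  by_cases hw : w = 0
  · rw [hw, hL.zero]; exact bot_le
  · exact (hL.eq_of_mem h hw).le

end IsSpreadMap

/-- The lines of `T` are the cosets of the members of the group partition `L`, and the parallel
classes are the sets of all cosets of one member. -/
structure IsCosetSpace {P : Type*} [AddCommGroup P] {v k : ℕ} (T : SpernerSpace P v k)
    (L : P → AddSubgroup P) : Prop where
  spread : IsSpreadMap L k
  mem_lines : ∀ l, l ∈ T.lines ↔ ∃ w, w ≠ 0 ∧ ∃ a, l = {x | x - a ∈ L w}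
  mem_classes : ∀ c, c ∈ T.classes ↔ ∃ w, w ≠ 0 ∧ c = {l | ∃ a, l = {x | x - a ∈ L w}}

open Classical in
/-- The spread element through a nonzero vector. -/
noncomputable def ProjSpread.through {K V : Type*} [Field K] [AddCommGroup V] [Module K V] {n : ℕ}
    (S : ProjSpread K V n) (v : V) : Submodule K V :=
  if h : v = 0 then ⊥ else (S.existsUnique_mem v h).choose

namespace ProjSpread

variable {K V : Type*} [Field K] [AddCommGroup V] [Module K V] {n : ℕ} (S : ProjSpread K V n)

theorem through_zero : S.through 0 = ⊥ := by simp [through]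

theorem through_mem {v : V} (h : v ≠ 0) : S.through v ∈ S.elements := by
  rw [through, dif_neg h]; exact (S.existsUnique_mem v h).choose_spec.1.1

theorem self_mem_through (v : V) : v ∈ S.through v := by
  by_cases h : v = 0
  · simp [h]
  · rw [through, dif_neg h]; exact (S.existsUnique_mem v h).choose_spec.1.2

theorem through_eq {v : V} (h : v ≠ 0) {W : Submodule K V} (hW : W ∈ S.elements) (hv : v ∈ W) :
    S.through v = W :=
  (S.existsUnique_mem v h).unique ⟨S.through_mem h, S.self_mem_through v⟩ ⟨hW, hv⟩

end ProjSpread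

theorem AddEquiv.image_eq_affineCoset_iff {P K V : Type*} [AddCommGroup P] [Field K]
    [AddCommGroup V] [Module K V] (g : P ≃+ V) (W : Submodule K V) (l : Set P) (a : P) :
    g '' l = affineCoset W (g a) ↔
      l = {x | x - a ∈ W.toAddSubgroup.comap (g : P →+ V)} := by
  have : affineCoset W (g a) = g '' {x | x - a ∈ W.toAddSubgroup.comap (g : P →+ V)} := by
    ext y
    obtain ⟨x, rfl⟩ := g.surjective y
    simp [affineCoset]
  rw [this, g.injective.image_injective.eq_iff]

theorem AddEquiv.setOf_affineCoset_eq_image {P K V : Type*} [AddCommGroup P] [Field K]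
    [AddCommGroup V] [Module K V] (g : P ≃+ V) (W : Submodule K V) :
    {l | ∃ a, l = affineCoset W a} = (fun l : Set P => g '' l) ''
      {l | ∃ a, l = {x | x - a ∈ W.toAddSubgroup.comap (g : P →+ V)}} := by
  ext l
  constructor
  · rintro ⟨a, rfl⟩
    obtain ⟨a, rfl⟩ := g.surjective a
    exact ⟨_, ⟨a, rfl⟩, (g.image_eq_affineCoset_iff _ _ _).2 rfl⟩
  · rintro ⟨l, ⟨a, ha⟩, rfl⟩
    exact ⟨g a, (g.image_eq_affineCoset_iff _ _ _).2 ha⟩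

theorem IsCosetSpace.of_addEquiv {P K V : Type*} [AddCommGroup P] [Field K] [AddCommGroup V]
    [Module K V] {n v k : ℕ} (S : ProjSpread K V n) (g : P ≃+ V) (T : SpernerSpace P v k)
    (hk : 1 < k)
    (hl : ∀ l, l ∈ T.lines ↔ ∃ W ∈ S.elements, ∃ a, g '' l = affineCoset W a)
    (hc : ∀ c, c ∈ T.classes ↔
      ∃ W ∈ S.elements, (fun l : Set P => g '' l) '' c = {l | ∃ a, l = affineCoset W a}) :
    IsCosetSpace T (fun x => (S.through (g x)).toAddSubgroup.comap (g : P →+ V)) := by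
  have hcard : ∀ l ∈ T.lines, l.ncard = k := fun l h => (T.isDesign.2.2.1 l h).2
  -- `1 < k` rules out zero-dimensional spread elements, so each one is the member through some
  -- nonzero vector.
  have hW : ∀ W ∈ S.elements, ∃ w : P, w ≠ 0 ∧ S.through (g w) = W := by
    intro W hW
    have h1 : {x | x - 0 ∈ W.toAddSubgroup.comap (g : P →+ V)} ∈ T.lines :=
      (hl _).2 ⟨W, hW, g 0, (g.image_eq_affineCoset_iff W _ 0).2 rfl⟩
    have h2 := hcard _ h1
    have h3 : 0 ∈ {x | x - 0 ∈ W.toAddSubgroup.comap (g : P →+ V)} := by simp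
    obtain ⟨w, hw, hne⟩ := Set.exists_ne_of_one_lt_ncard (h2 ▸ hk) (0 : P)
    refine ⟨w, hne, S.through_eq (by simpa using hne) hW (by simpa using hw)⟩
  have hlines : ∀ l, l ∈ T.lines ↔ ∃ w, w ≠ 0 ∧ ∃ a, l =
      {x | x - a ∈ (S.through (g w)).toAddSubgroup.comap (g : P →+ V)} := by
    intro l
    rw [hl]
    constructor
    · rintro ⟨W, h, a, ha⟩
      obtain ⟨w, hw, rfl⟩ := hW W h
      obtain ⟨a, rfl⟩ := g.surjective a
      exact ⟨w, hw, a, (g.image_eq_affineCoset_iff _ _ _).1 ha⟩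
    · rintro ⟨w, hw, a, ha⟩
      exact ⟨_, S.through_mem (by simpa using hw), g a, (g.image_eq_affineCoset_iff _ _ _).2 ha⟩
  refine ⟨⟨?_, ?_, ?_, ?_⟩, hlines, ?_⟩
  · ext x; simp [S.through_zero]
  · intro x; simpa using S.self_mem_through (g x)
  · intro x w hw hw0
    have hx : x ≠ 0 := by
      rintro rfl
      simp [S.through_zero] at hw
      exact hw0 hw
    rw [S.through_eq (by simpa using hw0) (S.through_mem (v := g x) (by simpa using hx))
      (by simpa using hw)]
  · intro x hx
    rw [← hcard _ ((hlines _).2 ⟨x, hx, 0, rfl⟩)]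
    simp only [sub_zero]
    rfl
  · intro c
    rw [hc]
    constructor
    · rintro ⟨W, h, ha⟩
      obtain ⟨w, hw, rfl⟩ := hW W h
      rw [g.setOf_affineCoset_eq_image] at ha
      exact ⟨w, hw, g.injective.image_injective.image_injective ha⟩
    · rintro ⟨w, hw, rfl⟩
      exact ⟨_, S.through_mem (by simpa using hw), (g.setOf_affineCoset_eq_image _).symm⟩

/-- A translation Sperner space carries a group structure, with any given point as zero, of which
it is the coset space. -/
theorem SpernerSpace.IsTranslation.exists_isCosetSpace {P : Type*} {v k : ℕ}
    {T : SpernerSpace P v k} (hT : T.IsTranslation) (hk : 1 < k) (p : P) :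
    ∃ (_ : AddCommGroup P) (L : P → AddSubgroup P), IsCosetSpace T L ∧ p = 0 := by
  obtain ⟨K, _, _, d, n, S, f, hf, hf'⟩ := hT
  -- Shifting `f` to send `p` to zero only permutes the cosets of each subspace, so `g` is an
  -- isomorphism as well; the group law on `P` is pulled back along it.
  let g : P ≃ (Fin d → K) := f.trans (Equiv.addRight (-(f p)))
  have hg : ∀ l : Set P, g '' l = (fun y => y - f p) '' (f '' l) := by
    intro l
    rw [Set.image_image]
    exact Set.image_congr fun x _ => by simp [g, sub_eq_add_neg]
  have hco : ∀ (W : Submodule K (Fin d → K)) a (l : Set P), f '' l = affineCoset W a ↔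
      g '' l = affineCoset W (a - f p) := by
    intro W a l
    have : affineCoset W (a - f p) = (fun y => y - f p) '' affineCoset W a := by
      ext y
      constructor
      · intro h
        refine ⟨y + f p, ?_, by simp⟩
        have h' : y - (a - f p) ∈ W := h
        show y + f p - a ∈ W
        convert h' using 1
        abel
      · rintro ⟨z, hz, rfl⟩
        have hz' : z - a ∈ W := hz
        show z - f p - (a - f p) ∈ W
        simpa using hz'
    rw [hg, this, (sub_left_injective (b := f p)).image_injective.eq_iff]
  let : AddCommGroup P := g.addCommGroup
  refine ⟨inferInstance, _, IsCosetSpace.of_addEquiv S (g.addEquiv) T hk ?_ ?_, ?_⟩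
  · intro l
    rw [hf]
    constructor
    · rintro ⟨W, hW, a, ha⟩
      exact ⟨W, hW, _, (hco W a l).1 ha⟩
    · rintro ⟨W, hW, a, ha⟩
      refine ⟨W, hW, a + f p, (hco W _ l).2 ?_⟩
      rw [add_sub_cancel_right]
      exact ha
  · intro c
    rw [hf']
    have key : ∀ W : Submodule K (Fin d → K),
        ((fun l : Set P => f '' l) '' c = {l | ∃ a, l = affineCoset W a} ↔
        (fun l : Set P => g '' l) '' c = {l | ∃ a, l = affineCoset W a}) := by
      intro W
      have h1 : (fun l : Set P => g '' l) '' c =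
          (fun s => (fun y => y - f p) '' s) '' ((fun l : Set P => f '' l) '' c) := by
        rw [Set.image_image]
        exact Set.image_congr fun l _ => hg l
      have h2 : {l | ∃ a, l = affineCoset W a} =
          (fun s => (fun y => y - f p) '' s) '' {l | ∃ a, l = affineCoset W a} := by
        have h3 : ∀ a, (fun y => y - f p) '' affineCoset W a = affineCoset W (a - f p) := by
          intro a
          have := (hco W a (f.symm '' affineCoset W a)).1 (by simp [Set.image_image])
          rw [← this, hg]
          simp [Set.image_image]
        ext l
        constructor
        · rintro ⟨a, rfl⟩
          exact ⟨_, ⟨a + f p, rfl⟩, by simp only [h3]; simp⟩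
        · rintro ⟨_, ⟨a, rfl⟩, rfl⟩
          exact ⟨_, h3 a⟩
      conv_rhs => rw [h1, h2]
      rw [(sub_left_injective (b := f p)).image_injective.image_injective.eq_iff]
    constructor
    · rintro ⟨W, hW, ha⟩
      exact ⟨W, hW, (key W).1 ha⟩
    · rintro ⟨W, hW, ha⟩
      exact ⟨W, hW, (key W).2 ha⟩
  · apply g.injective
    have h0 : g (0 : P) = 0 := map_zero g.addEquiv
    rw [h0]
    simp [g]

/-! ### Saturated subgroups and normal directions -/

theorem AddSubgroup.card_sup_of_disjoint {V : Type*} [AddCommGroup V] {H K : AddSubgroup V}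
    (h : ∀ x ∈ H, x ∈ K → x = 0) : Nat.card ↥(H ⊔ K) = Nat.card H * Nat.card K := by
  rw [← Nat.card_prod]
  symm
  refine Nat.card_congr (Equiv.ofBijective
    (fun p : H × K => (⟨p.1 + p.2, AddSubgroup.add_mem_sup p.1.2 p.2.2⟩ : ↥(H ⊔ K))) ⟨?_, ?_⟩)
  · rintro ⟨⟨a, ha⟩, ⟨b, hb⟩⟩ ⟨⟨a', ha'⟩, ⟨b', hb'⟩⟩ hab
    have h1 : a + b = a' + b' := congrArg Subtype.val hab
    have h2 : a - a' = b' - b := by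
      rw [sub_eq_sub_iff_add_eq_add, h1, add_comm]
    have h3 : a - a' = 0 := h _ (H.sub_mem ha ha') (h2 ▸ K.sub_mem hb' hb)
    have h4 : b' - b = 0 := h2 ▸ h3
    rw [sub_eq_zero] at h3 h4
    subst h3 h4
    rfl
  · rintro ⟨x, hx⟩
    obtain ⟨a, ha, b, hb, rfl⟩ := AddSubgroup.mem_sup.1 hx
    exact ⟨⟨⟨a, ha⟩, ⟨b, hb⟩⟩, rfl⟩

/-- `U` is a union of members of the partition. -/
def IsSaturated {V : Type*} [AddCommGroup V] (L : V → AddSubgroup V) (U : AddSubgroup V) : Prop :=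
  ∀ u ∈ U, L u ≤ U

/-- The join of `L c` with any member is again a union of members. -/
def IsNormalDirection {V : Type*} [AddCommGroup V] (L : V → AddSubgroup V) (c : V) : Prop :=
  ∀ v, IsSaturated L (L c ⊔ L v)

section saturated

variable {V : Type*} [AddCommGroup V] {L : V → AddSubgroup V} {Q : ℕ}

theorem IsSpreadMap.isSaturated (hL : IsSpreadMap L Q) (v : V) : IsSaturated L (L v) :=
  fun _ hu => hL.le_of_mem hu

theorem IsSpreadMap.isSaturated_bot (hL : IsSpreadMap L Q) : IsSaturated L ⊥ :=
  hL.zero ▸ hL.isSaturated 0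

/-- An element `a + b` with `b ∈ U` already lies in `L c ⊔ L b`, which is saturated by normality and
contained in `L c ⊔ U`. -/
theorem IsNormalDirection.isSaturated_sup {c : V} (hc : IsNormalDirection L c) {U : AddSubgroup V}
    (hU : IsSaturated L U) (hL : IsSpreadMap L Q) : IsSaturated L (L c ⊔ U) := by
  intro x hx
  obtain ⟨a, ha, b, hb, rfl⟩ := AddSubgroup.mem_sup.1 hx
  exact (hc b _ (AddSubgroup.add_mem_sup ha (hL.self_mem b))).trans (sup_le_sup_left (hU b hb) _)

theorem IsSpreadMap.isSaturated_iSup_sup {ι : Type*} (hL : IsSpreadMap L Q) (s : Finset ι)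
    {w : ι → V} (hw : ∀ i ∈ s, IsNormalDirection L (w i)) {U : AddSubgroup V}
    (hU : IsSaturated L U) : IsSaturated L ((⨆ i ∈ s, L (w i)) ⊔ U) := by
  classical
  induction s using Finset.induction_on with
  | empty => simpa using hU
  | insert i s his ih =>
    rw [Finset.iSup_insert, sup_assoc]
    exact (hw i (Finset.mem_insert_self i s)).isSaturated_sup
      (ih fun j hj => hw j (Finset.mem_insert_of_mem hj)) hL

theorem IsSpreadMap.isSaturated_iSup {ι : Type*} (hL : IsSpreadMap L Q) (s : Finset ι)
    {w : ι → V} (hw : ∀ i ∈ s, IsNormalDirection L (w i)) :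
    IsSaturated L (⨆ i ∈ s, L (w i)) := by
  simpa using hL.isSaturated_iSup_sup s hw hL.isSaturated_bot

theorem IsSpreadMap.eq_zero_of_mem (hL : IsSpreadMap L Q) {U : AddSubgroup V}
    (hU : IsSaturated L U) {e x : V} (he : e ∉ U) (hx : x ∈ U) (hxe : x ∈ L e) : x = 0 := by
  by_contra h
  exact he (hU x hx (hL.mem_symm hxe h))

theorem IsSpreadMap.card_sup (hL : IsSpreadMap L Q) {U : AddSubgroup V}
    (hU : IsSaturated L U) {e : V} (he : e ∉ U) : Nat.card ↥(U ⊔ L e) = Nat.card U * Q := by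
  have h0 : e ≠ 0 := fun h => he (h ▸ U.zero_mem)
  rw [AddSubgroup.card_sup_of_disjoint fun x hx hxe => hL.eq_zero_of_mem hU he hx hxe,
    hL.card e h0]

end saturated

/-! ### Line-closed sets, affine planes and normal lines -/

namespace IsCosetSpace

variable {P : Type*} [AddCommGroup P] {v k : ℕ} {T : SpernerSpace P v k} {L : P → AddSubgroup P}

theorem coset_mem_lines (hT : IsCosetSpace T L) {w : P} (hw : w ≠ 0) (a : P) :
    {x | x - a ∈ L w} ∈ T.lines :=
  (hT.mem_lines _).2 ⟨w, hw, a, rfl⟩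

theorem coe_mem_lines (hT : IsCosetSpace T L) {w : P} (hw : w ≠ 0) : (L w : Set P) ∈ T.lines := by
  simpa using hT.coset_mem_lines hw 0

theorem eq_coset (hT : IsCosetSpace T L) {l : Set P} (hl : l ∈ T.lines) {a : P} (ha : a ∈ l) :
    ∃ w, w ≠ 0 ∧ l = {x | x - a ∈ L w} := by
  obtain ⟨w, hw, b, rfl⟩ := (hT.mem_lines l).1 hl
  refine ⟨w, hw, ?_⟩
  have ha' : a - b ∈ L w := ha
  ext x
  show x - b ∈ L w ↔ x - a ∈ L w
  rw [← sub_add_sub_cancel x a b, (L w).add_mem_cancel_right ha']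

theorem eq_coe (hT : IsCosetSpace T L) {l : Set P} (hl : l ∈ T.lines) (h0 : 0 ∈ l) :
    ∃ w, w ≠ 0 ∧ l = L w := by
  obtain ⟨w, hw, h⟩ := hT.eq_coset hl h0
  exact ⟨w, hw, by simpa using h⟩

theorem eq_coe_of_mem (hT : IsCosetSpace T L) {l : Set P} (hl : l ∈ T.lines) (h0 : 0 ∈ l) {x : P}
    (hx : x ∈ l) (hx0 : x ≠ 0) : l = L x := by
  obtain ⟨w, hw, rfl⟩ := hT.eq_coe hl h0
  rw [hT.spread.eq_of_mem hx hx0]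

theorem isLineClosed (hT : IsCosetSpace T L) {U : AddSubgroup P} (hU : IsSaturated L U) :
    T.IsLineClosed U := by
  intro x hx y hy hxy l hl hxl hyl
  obtain ⟨w, hw, rfl⟩ := hT.eq_coset hl hxl
  have hd : y - x ∈ L w := hyl
  have hle : L w ≤ U := by
    rw [← hT.spread.eq_of_mem hd (sub_ne_zero.2 hxy.symm)]
    exact hU _ (U.sub_mem hy hx)
  intro z hz
  simpa using U.add_mem (hle hz) hx

theorem le_of_isLineClosed (hT : IsCosetSpace T L) {M : Set P} (hM : T.IsLineClosed M)
    (h0 : 0 ∈ M) {x : P} (hx : x ∈ M) : (L x : Set P) ⊆ M := by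
  by_cases h : x = 0
  · subst h
    intro y hy
    rwa [hT.spread.eq_zero_of_mem_zero hy]
  · exact hM 0 h0 x hx (Ne.symm h) _ (hT.coe_mem_lines h) (L x).zero_mem (hT.spread.self_mem x)

end IsCosetSpace

namespace SpernerSpace

variable {P : Type*} {v k : ℕ} (T : SpernerSpace P v k)

theorem subset_manifold (X : Set P) : X ⊆ T.manifold X :=
  Set.subset_sInter fun _ h => h.1

theorem isLineClosed_manifold (X : Set P) : T.IsLineClosed (T.manifold X) := by
  intro x hx y hy hxy l hl hxl hyl
  exact Set.subset_sInter fun M hM =>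
    hM.2 x (hx M hM) y (hy M hM) hxy l hl hxl hyl

theorem manifold_subset {X M : Set P} (h : X ⊆ M) (hM : T.IsLineClosed M) : T.manifold X ⊆ M :=
  Set.sInter_subset_of_mem ⟨h, hM⟩

end SpernerSpace

namespace IsCosetSpace

variable {P : Type*} [AddCommGroup P] {v k : ℕ} {T : SpernerSpace P v k} {L : P → AddSubgroup P}

/-- Joining zero to `x` inside the plane gives `L x ⊆ M`, and the parallel to it through `y` gives
`x + y ∈ M`. The order of the plane is `k` because it contains a whole line. -/
theorem exists_addSubgroup_of_isAffinePlane (hT : IsCosetSpace T L) {M : Set P}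
    (hM : T.IsAffinePlane M) (h0 : 0 ∈ M) {l : Set P} (hl : l ∈ T.lines) (hlM : l ⊆ M) :
    ∃ U : AddSubgroup P, M = U ∧ IsSaturated L U ∧ Nat.card U = k ^ 2 := by
  obtain ⟨m, -, ⟨hfin, hcard, hlines, hjoin⟩, -, -, hpart⟩ := hM
  have hm : m = k := by
    rw [← (hlines l ⟨hl, hlM⟩).2, (T.isDesign.2.2.1 l hl).2]
  subst hm
  have hLM : ∀ x ∈ M, (L x : Set P) ⊆ M := by
    intro x hx
    by_cases h : x = 0
    · subst h
      intro y hy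
      rwa [hT.spread.eq_zero_of_mem_zero hy]
    · obtain ⟨b, ⟨⟨hb, hbM⟩, h0b, hxb⟩, -⟩ := hjoin 0 h0 x hx (Ne.symm h)
      rwa [← hT.eq_coe_of_mem hb h0b hxb h]
  have hadd : ∀ x ∈ M, ∀ y ∈ M, x + y ∈ M := by
    intro x hx y hy
    by_cases h : x = 0
    · simpa [h] using hy
    · have hc := (hT.mem_classes _).2 ⟨x, h, rfl⟩
      have hd : {b | b ∈ {b | ∃ a, b = {y | y - a ∈ L x}} ∧ b ⊆ M} ∈ T.inducedClasses M :=
        ⟨⟨(L x : Set P), ⟨0, by simp⟩, hLM x hx⟩, _, hc, rfl⟩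
      obtain ⟨b, ⟨⟨⟨a, rfl⟩, hbM⟩, hyb⟩, -⟩ := hpart _ hd y hy
      apply hbM
      have hya : y - a ∈ L x := hyb
      have := (L x).add_mem (hT.spread.self_mem x) hya
      show x + y - a ∈ L x
      rwa [add_sub_assoc]
  refine ⟨⟨⟨⟨M, fun {a b} ha hb => hadd a ha b hb⟩, h0⟩, fun {x} hx =>
    hLM x hx ((L x).neg_mem (hT.spread.self_mem x))⟩, rfl, hLM, hcard⟩

theorem exists_of_isNormalLine [Finite P] (hT : IsCosetSpace T L) {l : Set P}
    (hl : T.IsNormalLine l) (h0 : 0 ∈ l) :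
    ∃ w, w ≠ 0 ∧ l = L w ∧ IsNormalDirection L w ∧
      ∀ x ∉ L w, T.manifold (insert x (L w : Set P)) = ↑(L w ⊔ L x) := by
  obtain ⟨w, hw, rfl⟩ := hT.eq_coe hl.1 h0
  have key : ∀ x ∉ L w, IsSaturated L (L w ⊔ L x) ∧
      T.manifold (insert x (L w : Set P)) = ↑(L w ⊔ L x) := by
    intro x hx
    have hsub := T.subset_manifold (insert x (L w : Set P))
    obtain ⟨U, hU, hsat, hcard⟩ := hT.exists_addSubgroup_of_isAffinePlane (hl.2 x hx)
      (hsub (Or.inr h0)) hl.1 (fun y hy => hsub (Or.inr hy))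
    rw [hU] at hsub
    have hle : L w ⊔ L x ≤ U :=
      sup_le (fun y hy => hsub (Or.inr hy)) (hsat x (hsub (Or.inl rfl)))
    -- Both groups have order `k ^ 2`, so the plane is no larger than the join of the two members.
    have hcard' : Nat.card ↥(L w ⊔ L x) = Nat.card U := by
      rw [hT.spread.card_sup (hT.spread.isSaturated w) hx, hcard, hT.spread.card w hw, sq]
    have heq : L w ⊔ L x = U := AddSubgroup.eq_of_le_of_card_ge hle hcard'.ge
    rw [heq]
    exact ⟨hsat, hU⟩
  refine ⟨w, hw, rfl, fun x => ?_, fun x hx => (key x hx).2⟩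
  by_cases hx : x ∈ L w
  · rw [sup_eq_left.2 (hT.spread.le_of_mem hx)]
    exact hT.spread.isSaturated w
  · exact (key x hx).1

/-- A normal member and a point off it generate the full group `L w ⊔ L x`, so a line-closed set
containing `L w` is invariant under translation by `L w`. This gives closure under addition in every
characteristic. -/
theorem add_mem_of_isLineClosed (hT : IsCosetSpace T L) {M : Set P}
    (hM : T.IsLineClosed M) {w : P} (hw : ∀ x ∉ L w,
      T.manifold (insert x (L w : Set P)) = ↑(L w ⊔ L x)) (hwM : (L w : Set P) ⊆ M) {a x : P}
    (ha : a ∈ L w) (hx : x ∈ M) : a + x ∈ M := by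
  by_cases h : x ∈ L w
  · exact hwM ((L w).add_mem ha h)
  · have := T.manifold_subset (Set.insert_subset hx hwM) hM
    rw [hw x h] at this
    exact this (AddSubgroup.add_mem_sup ha (hT.spread.self_mem x))

theorem manifold_iUnion {ι : Type*} (hT : IsCosetSpace T L) {w : ι → P} {s : Finset ι}
    (hs : s.Nonempty) (hn : ∀ i ∈ s, IsNormalDirection L (w i))
    (hw : ∀ i ∈ s, ∀ x ∉ L (w i), T.manifold (insert x (L (w i) : Set P)) = ↑(L (w i) ⊔ L x)) :
    T.manifold (⋃ i ∈ s, (L (w i) : Set P)) = ↑(⨆ i ∈ s, L (w i)) := by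
  classical
  apply Set.Subset.antisymm
  · refine T.manifold_subset (Set.iUnion₂_subset fun i hi => ?_)
      (hT.isLineClosed (hT.spread.isSaturated_iSup s hn))
    exact SetLike.coe_subset_coe.2 (le_iSup₂ (f := fun i (_ : i ∈ s) => L (w i)) i hi)
  · set M := T.manifold (⋃ i ∈ s, (L (w i) : Set P)) with hM
    have hcl : T.IsLineClosed M := T.isLineClosed_manifold _
    have hsub : ∀ i ∈ s, (L (w i) : Set P) ⊆ M := fun i hi =>
      (Set.subset_iUnion₂ (s := fun i (_ : i ∈ s) => (L (w i) : Set P)) i hi).trans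
        (T.subset_manifold _)
    have h0 : (0 : P) ∈ M := by
      obtain ⟨i, hi⟩ := hs
      exact hsub i hi (L (w i)).zero_mem
    have key : ∀ t ⊆ s, ∀ x ∈ ⨆ i ∈ t, L (w i), x ∈ M := by
      intro t
      induction t using Finset.induction_on with
      | empty =>
        intro _ x hx
        have : x = 0 := by simpa using hx
        rwa [this]
      | insert i t hit ih =>
        intro hts x hx
        rw [Finset.iSup_insert] at hx
        obtain ⟨a, ha, b, hb, rfl⟩ := AddSubgroup.mem_sup.1 hx
        have his := hts (Finset.mem_insert_self i t)
        exact hT.add_mem_of_isLineClosed hcl (hw i his) (hsub i his) ha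
          (ih ((Finset.subset_insert i t).trans hts) b hb)
    exact fun x hx => key s subset_rfl x hx

end IsCosetSpace

/-! ### Diagonal spreads and the relation between two coordinates -/

/-- A partition of `ι → A` into subgroups of order `|A|` that contains the diagonal and is
preserved by the coordinate projections. -/
structure IsDiagonalSpread {ι A : Type*} [DecidableEq ι] [AddCommGroup A]
    (L : (ι → A) → AddSubgroup (ι → A)) : Prop where
  spread : IsSpreadMap L (Nat.card A)
  piecewise_mem : ∀ (s : Finset ι) (v w : ι → A), w ∈ L v → s.piecewise w 0 ∈ L (s.piecewise v 0)
  const_mem : ∀ a b : A, a ≠ 0 → (fun _ => b) ∈ L fun _ => a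

namespace IsDiagonalSpread

variable {ι A : Type*} [DecidableEq ι] [AddCommGroup A] {L : (ι → A) → AddSubgroup (ι → A)}

theorem apply_eq_zero (hL : IsDiagonalSpread L) {v w : ι → A} (h : w ∈ L v) {i : ι}
    (hi : v i = 0) : w i = 0 := by
  have h1 := hL.piecewise_mem {i} v w h
  have h2 : ({i} : Finset ι).piecewise v 0 = 0 := by
    ext j
    by_cases hj : j = i
    · subst hj; simpa using hi
    · simp [hj]
  rw [h2] at h1
  simpa using congrFun (hL.spread.eq_zero_of_mem_zero h1) i

theorem eq_of_apply_eq (hL : IsDiagonalSpread L) {v w w' : ι → A} (hw : w ∈ L v) (hw' : w' ∈ L v)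
    {i : ι} (hi : v i ≠ 0) (h : w i = w' i) : w = w' := by
  by_contra hne
  have h1 : w - w' ≠ 0 := sub_ne_zero.2 hne
  exact hi (hL.apply_eq_zero (hL.spread.mem_symm ((L v).sub_mem hw hw') h1) (by simp [h]))

theorem exists_apply_eq [Finite A] [Finite ι] (hL : IsDiagonalSpread L) {v : ι → A} {i : ι}
    (hi : v i ≠ 0) (b : A) : ∃ w ∈ L v, w i = b := by
  have hv : v ≠ 0 := fun h => hi (by simp [h])
  have hinj : Function.Injective fun w : L v => (w : ι → A) i := fun w w' h =>
    Subtype.ext (hL.eq_of_apply_eq w.2 w'.2 hi h)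
  obtain ⟨w, hw⟩ := (hinj.bijective_of_nat_card_le (hL.spread.card v hv).ge).2 b
  exact ⟨w, w.2, hw⟩

/-- After projection to the coordinates `i` and `j`, `v` agrees with a diagonal vector, whose member
consists of diagonal vectors; one nonzero coordinate then determines the point. -/
theorem apply_eq_apply (hL : IsDiagonalSpread L) {v w : ι → A} (h : w ∈ L v) {i j : ι}
    (hij : v i = v j) : w i = w j := by
  by_cases hi : v i = 0
  · rw [hL.apply_eq_zero h hi, hL.apply_eq_zero h (hij ▸ hi)]
  · have h1 := hL.piecewise_mem {i, j} v w h
    have h2 : ({i, j} : Finset ι).piecewise v 0 = ({i, j} : Finset ι).piecewise (fun _ => v i) 0 := by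
      ext k
      by_cases hk : k ∈ ({i, j} : Finset ι)
      · rw [Finset.piecewise_eq_of_mem _ _ _ hk, Finset.piecewise_eq_of_mem _ _ _ hk]
        rcases (by simpa using hk : k = i ∨ k = j) with rfl | rfl
        · rfl
        · exact hij.symm
      · rw [Finset.piecewise_eq_of_notMem _ _ _ hk, Finset.piecewise_eq_of_notMem _ _ _ hk]
    have h3 := hL.piecewise_mem {i, j} _ _ (hL.const_mem (v i) (w i) hi)
    rw [← h2] at h3
    have := congrFun (hL.eq_of_apply_eq (i := i) h1 h3 (by simpa using hi) (by simp)) j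
    simpa using this.symm

theorem piecewise_const_mem (hL : IsDiagonalSpread L) {s : Finset ι} {a : A} (ha : a ≠ 0) (b : A) :
    s.piecewise (fun _ => b) 0 ∈ L (s.piecewise (fun _ => a) 0) :=
  hL.piecewise_mem s _ _ (hL.const_mem a b ha)

theorem piecewise_pair {i j : ι} (hij : i ≠ j) (v : ι → A) :
    ({i, j} : Finset ι).piecewise v 0 = Pi.single i (v i) + Pi.single j (v j) := by
  ext k
  by_cases hi : k = i
  · subst hi; simp [hij]
  · by_cases hj : k = j
    · subst hj; simp [hi]
    · simp [hi, hj]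

theorem exists_mem_of_pair [Finite A] [Finite ι] (hL : IsDiagonalSpread L) {v : ι → A} {i j : ι}
    (hij : i ≠ j) {a b : A}
    (h : Pi.single i a + Pi.single j b ∈ L (Pi.single i (v i) + Pi.single j (v j))) :
    ∃ w ∈ L v, w i = a ∧ w j = b := by
  have hp : ∀ w ∈ L v, Pi.single i (w i) + Pi.single j (w j) ∈
      L (Pi.single i (v i) + Pi.single j (v j)) := by
    intro w hw
    rw [← piecewise_pair hij, ← piecewise_pair hij]
    exact hL.piecewise_mem _ _ _ hw
  by_cases hi : v i = 0
  · have ha : a = 0 := by simpa [hij] using hL.apply_eq_zero (i := i) h (by simp [hi, hij])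
    by_cases hj : v j = 0
    · have hb : b = 0 := by
        simpa [hij.symm] using hL.apply_eq_zero (i := j) h (by simp [hj, hij.symm])
      exact ⟨0, (L v).zero_mem, ha.symm, hb.symm⟩
    · obtain ⟨w, hw, rfl⟩ := hL.exists_apply_eq hj b
      exact ⟨w, hw, by rw [ha, hL.apply_eq_zero hw hi], rfl⟩
  · obtain ⟨w, hw, rfl⟩ := hL.exists_apply_eq hi a
    have := congrFun (hL.eq_of_apply_eq (i := i) (hp w hw) h (by simpa [hij] using hi)
      (by simp [hij])) j
    exact ⟨w, hw, rfl, by simpa [hij.symm] using this⟩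

/-- `(a', b')` lies on the member through `(a, b)`, in any two of the coordinates. -/
def Rel (L : (ι → A) → AddSubgroup (ι → A)) (a b a' b' : A) : Prop :=
  ∀ i j, i ≠ j → Pi.single i a' + Pi.single j b' ∈ L (Pi.single i a + Pi.single j b)

section rel

variable {a b c a' b' c' : A}

/-- Put `b` in both coordinates `j` and `k`. Points of the resulting member keep these two
coordinates equal, so projecting to `{i, k}` carries the relation over from `{i, j}`. -/
theorem single_add_single_mem_of_ne [Finite A] [Finite ι] (hL : IsDiagonalSpread L) {i j k : ι}
    (hij : i ≠ j) (hik : i ≠ k)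
    (h : Pi.single i a' + Pi.single j b' ∈ L (Pi.single i a + Pi.single j b)) :
    Pi.single i a' + Pi.single k b' ∈ L (Pi.single i a + Pi.single k b) := by
  by_cases hjk : j = k
  · rwa [← hjk]
  · let v : ι → A := Pi.single i a + Pi.single j b + Pi.single k b
    have hi : v i = a := by simp [v, hij, hik]
    have hj : v j = b := by simp [v, hij.symm, hjk]
    have hk : v k = b := by simp [v, hik.symm, Ne.symm hjk]
    rw [← hi, ← hj] at h
    obtain ⟨w, hw, rfl, rfl⟩ := hL.exists_mem_of_pair hij h
    have h1 := hL.piecewise_mem {i, k} v w hw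
    rwa [piecewise_pair hik, piecewise_pair hik, hi, hk,
      ← hL.apply_eq_apply hw (hj.trans hk.symm)] at h1

theorem rel_of_pair [Finite A] [Fintype ι] (hL : IsDiagonalSpread L) (h3 : 2 < Fintype.card ι)
    {i j : ι} (hij : i ≠ j)
    (h : Pi.single i a' + Pi.single j b' ∈ L (Pi.single i a + Pi.single j b)) :
    Rel L a b a' b' := by
  have key : ∀ {i j k : ι}, i ≠ j → k ≠ j →
      Pi.single i a' + Pi.single j b' ∈ L (Pi.single i a + Pi.single j b) →
      Pi.single k a' + Pi.single j b' ∈ L (Pi.single k a + Pi.single j b) := by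
    intro i j k hij hkj h
    rw [add_comm (Pi.single k a' : ι → A), add_comm (Pi.single k a : ι → A)]
    rw [add_comm (Pi.single i a' : ι → A), add_comm (Pi.single i a : ι → A)] at h
    exact hL.single_add_single_mem_of_ne hij.symm hkj.symm h
  intro i' j' hij'
  by_cases hi : i' = j
  · subst hi
    -- When the new first index is the old second one, the move has to pass through a third
    -- coordinate.
    obtain ⟨k, hk⟩ := Finset.exists_mem_notMem_of_card_lt_card (s := {i, i'}) (t := Finset.univ)
      (by rw [Finset.card_univ]; exact (Finset.card_le_two).trans_lt h3)
    simp only [Finset.mem_univ, true_and, Finset.mem_insert, Finset.mem_singleton, not_or] at hk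
    exact hL.single_add_single_mem_of_ne (Ne.symm hk.2) hij'
      (key (Ne.symm hk.1) (Ne.symm hk.2) (hL.single_add_single_mem_of_ne hij (Ne.symm hk.1) h))
  · exact hL.single_add_single_mem_of_ne hi hij' (key hij hi h)

theorem rel_of_mem [Finite A] [Fintype ι] (hL : IsDiagonalSpread L) (h3 : 2 < Fintype.card ι)
    {v w : ι → A} (h : w ∈ L v) {i j : ι} (hij : i ≠ j) : Rel L (v i) (v j) (w i) (w j) := by
  apply hL.rel_of_pair h3 hij
  rw [← piecewise_pair hij, ← piecewise_pair hij]
  exact hL.piecewise_mem _ _ _ h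

theorem Rel.symm (h : Rel L a b a' b') : Rel L b a b' a' := by
  intro i j hij
  rw [add_comm (Pi.single i b' : ι → A), add_comm (Pi.single i b : ι → A)]
  exact h j i hij.symm

theorem Rel.add (h : Rel L a b a' b') {a'' b'' : A} (h' : Rel L a b a'' b'') :
    Rel L a b (a' + a'') (b' + b'') := by
  intro i j hij
  have := (L _).add_mem (h i j hij) (h' i j hij)
  rw [Pi.single_add, Pi.single_add]
  convert this using 1
  abel

theorem Rel.unique [Nontrivial ι] (hL : IsDiagonalSpread L) (ha : a ≠ 0) {b'' : A}
    (h : Rel L a b a' b') (h' : Rel L a b a' b'') : b' = b'' := by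
  obtain ⟨i, j, hij⟩ := exists_pair_ne ι
  have := congrFun (hL.eq_of_apply_eq (i := i) (h i j hij) (h' i j hij) (by simpa [hij] using ha)
    (by simp [hij])) j
  simpa [hij.symm] using this

theorem Rel.rebase (hL : IsDiagonalSpread L) {a'' b'' : A} (h : Rel L a b a' b')
    (h' : Rel L a b a'' b'') (ha : a' ≠ 0) : Rel L a' b' a'' b'' := by
  intro i j hij
  rw [hL.spread.eq_of_mem (h i j hij)]
  · exact h' i j hij
  · intro h0
    have := congrFun h0 i
    exact ha (by simpa [hij] using this)

/-- The member through `(a, b, c)` in three coordinates has a point whose first two entries are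
`a'`, `b'`; its third entry is forced to be `c'`, and forgetting the middle coordinate gives the
composite. -/
theorem Rel.trans [Finite A] [Fintype ι] (hL : IsDiagonalSpread L) (h3 : 2 < Fintype.card ι)
    (hb : b ≠ 0) (h : Rel L a b a' b') (h' : Rel L b c b' c') : Rel L a c a' c' := by
  have : Nontrivial ι := Fintype.one_lt_card_iff_nontrivial.1 (by omega)
  obtain ⟨i, j, k, hij, hik, hjk⟩ := Fintype.two_lt_card_iff.1 h3
  let v : ι → A := Pi.single i a + Pi.single j b + Pi.single k c
  have hi : v i = a := by simp [v, hij, hik]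
  have hj : v j = b := by simp [v, hij.symm, hjk]
  have hk : v k = c := by simp [v, hik.symm, hjk.symm]
  obtain ⟨w, hw, hwi, hwj⟩ := hL.exists_mem_of_pair (v := v) hij (by rw [hi, hj]; exact h i j hij)
  have h1 := hL.rel_of_mem h3 hw hjk
  rw [hj, hk, hwj] at h1
  have h2 := hL.rel_of_mem h3 hw hik
  rwa [hi, hk, hwi, Rel.unique hL hb h1 h'] at h2

theorem rel_zero [Finite A] [Fintype ι] (hL : IsDiagonalSpread L) (h3 : 2 < Fintype.card ι)
    (ha : a ≠ 0) : Rel L a 0 a' 0 := by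
  have : Nontrivial ι := Fintype.one_lt_card_iff_nontrivial.1 (by omega)
  obtain ⟨i, j, hij⟩ := exists_pair_ne ι
  have h1 := hL.rel_of_mem h3 (hL.piecewise_mem {i} _ _ (hL.const_mem a a' ha)) hij
  simpa [hij.symm] using h1

theorem rel_self [Finite A] [Fintype ι] (hL : IsDiagonalSpread L) (h3 : 2 < Fintype.card ι)
    (ha : a ≠ 0) : Rel L a a a' a' := by
  have : Nontrivial ι := Fintype.one_lt_card_iff_nontrivial.1 (by omega)
  obtain ⟨i, j, hij⟩ := exists_pair_ne ι
  exact hL.rel_of_mem h3 (hL.const_mem a a' ha) hij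

theorem mem_of_rel [Finite A] [Finite ι] [Nontrivial ι] (hL : IsDiagonalSpread L) {v w : ι → A}
    (h : ∀ i j, i ≠ j → Rel L (v i) (v j) (w i) (w j)) : w ∈ L v := by
  by_cases hv : v = 0
  · have : w = 0 := by
      ext i
      obtain ⟨j, hj⟩ := exists_ne i
      have := hL.apply_eq_zero (i := i) (h i j hj.symm i j hj.symm) (by simp [hv])
      simpa [hj.symm] using this
    rw [this]
    exact (L v).zero_mem
  · obtain ⟨i, hi⟩ := Function.ne_iff.1 hv
    obtain ⟨u, hu, hui⟩ := hL.exists_apply_eq hi (w i)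
    have : u = w := by
      ext j
      by_cases hij : i = j
      · rw [← hij, hui]
      · have h1 := hL.piecewise_mem {i, j} v u hu
        rw [piecewise_pair hij, piecewise_pair hij, hui] at h1
        have := congrFun (hL.eq_of_apply_eq (i := i) h1 (h i j hij i j hij)
          (by simpa [hij] using hi) (by simp [hij])) j
        simpa [Ne.symm hij] using this
    rwa [← this]

end rel

/-! ### Slopes of members -/

/-- The endomorphisms whose graph is a member of the partition. -/
def graphs (L : (ι → A) → AddSubgroup (ι → A)) : Set (AddMonoid.End A) :=
  {f | ∀ a a', a ≠ 0 → Rel L a (f a) a' (f a')}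

section graphs

variable {f g : AddMonoid.End A}

theorem eq_of_mem_graphs [Nontrivial ι] (hL : IsDiagonalSpread L) (hf : f ∈ graphs L)
    (hg : g ∈ graphs L) {a : A} (ha : a ≠ 0) (h : f a = g a) : f = g := by
  ext x
  have h1 := hf a x ha
  rw [h] at h1
  exact Rel.unique hL ha h1 (hg a x ha)

variable [Finite A] [Fintype ι]

theorem zero_mem_graphs (hL : IsDiagonalSpread L) (h3 : 2 < Fintype.card ι) : 0 ∈ graphs L :=
  fun _ _ ha => hL.rel_zero h3 ha

theorem one_mem_graphs (hL : IsDiagonalSpread L) (h3 : 2 < Fintype.card ι) : 1 ∈ graphs L :=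
  fun _ _ ha => hL.rel_self h3 ha

theorem mul_mem_graphs (hL : IsDiagonalSpread L) (h3 : 2 < Fintype.card ι) (hf : f ∈ graphs L)
    (hg : g ∈ graphs L) : f * g ∈ graphs L := by
  have : Nontrivial ι := Fintype.one_lt_card_iff_nontrivial.1 (by omega)
  intro a a' ha
  by_cases h : g a = 0
  · have hg0 : g = 0 := hL.eq_of_mem_graphs hg (hL.zero_mem_graphs h3) ha h
    simpa [hg0] using hL.rel_zero h3 ha
  · exact (hg a a' ha).trans hL h3 h (hf (g a) (g a') h)

/-- The member through `(a, b)` has exactly one point over each first coordinate, so it is the graph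
of a map, additive because the member is a subgroup. `Rel.rebase` moves the base point from `a` to
any nonzero point. -/
theorem exists_mem_graphs (hL : IsDiagonalSpread L) (h3 : 2 < Fintype.card ι) {a : A}
    (ha : a ≠ 0) (b : A) : ∃ f ∈ graphs L, f a = b := by
  have : Nontrivial ι := Fintype.one_lt_card_iff_nontrivial.1 (by omega)
  obtain ⟨i, j, hij⟩ := exists_pair_ne ι
  have hex : ∀ x, ∃ y, Rel L a b x y := by
    intro x
    obtain ⟨w, hw, hwi⟩ := hL.exists_apply_eq (v := Pi.single i a + Pi.single j b) (i := i)
      (by simpa [hij] using ha) x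
    refine ⟨w j, ?_⟩
    have := hL.rel_of_mem h3 hw hij
    simpa [hij, hij.symm, hwi] using this
  choose f hf using hex
  refine ⟨AddMonoidHom.mk' f fun x y => Rel.unique hL ha (hf (x + y)) ((hf x).add (hf y)),
    fun x y hx => (hf x).rebase hL (hf y) hx, ?_⟩
  exact Rel.unique hL ha (hf a) fun i j _ => hL.spread.self_mem _

theorem injective_of_mem_graphs (hL : IsDiagonalSpread L) (h3 : 2 < Fintype.card ι)
    (hf : f ∈ graphs L) (h0 : f ≠ 0) : Function.Injective f := by
  have : Nontrivial ι := Fintype.one_lt_card_iff_nontrivial.1 (by omega)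
  rw [injective_iff_map_eq_zero]
  intro a ha
  by_contra h
  exact h0 (hL.eq_of_mem_graphs hf (hL.zero_mem_graphs h3) h ha)

end graphs

end IsDiagonalSpread

namespace IsDiagonalSpread

variable {ι A : Type*} [DecidableEq ι] [AddCommGroup A] {L : (ι → A) → AddSubgroup (ι → A)}
  [Finite A] [Fintype ι] {f g : AddMonoid.End A}

/-! ### Subtraction of slopes from one extra normal direction -/

section normal

variable {s : Finset ι} {a₀ : A}

/-- In coordinates `i, j, k`, adding the vector `-g d` on `s` to `(f d, g d, d)` gives `(f d - g d,
0, d)`. By normality, each point of the new member splits into a vector constant on `s` and a point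
`(f d', g d', d')`; the zero at `j` makes that constant `-g d'`. -/
theorem sub_mem_graphs_of_notMem (hL : IsDiagonalSpread L) (h3 : 2 < Fintype.card ι)
    (h0 : a₀ ≠ 0) (hN : IsNormalDirection L (s.piecewise (fun _ => a₀) 0)) {i j k : ι}
    (hij : i ≠ j) (hik : i ≠ k) (hjk : j ≠ k) (hi : i ∈ s) (hj : j ∈ s) (hk : k ∉ s)
    (hf : f ∈ graphs L) (hg : g ∈ graphs L) : f - g ∈ graphs L := by
  have : Nontrivial ι := Fintype.one_lt_card_iff_nontrivial.1 (by omega)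
  intro d d' hd
  let v : ι → A := Pi.single i (f d) + Pi.single j (g d) + Pi.single k d
  have hvi : v i = f d := by simp [v, hij, hik]
  have hvj : v j = g d := by simp [v, hij.symm, hjk]
  have hvk : v k = d := by simp [v, hik.symm, hjk.symm]
  let x : ι → A := s.piecewise (fun _ => -g d) 0
  obtain ⟨z, hz, hzk⟩ := hL.exists_apply_eq (v := x + v) (i := k) (by simpa [x, hk, hvk]) d'
  obtain ⟨x', hx', y, hy, rfl⟩ := AddSubgroup.mem_sup.1 (hN v _ (AddSubgroup.add_mem_sup
    (hL.piecewise_const_mem h0 (-g d)) (hL.spread.self_mem v)) hz)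
  have hxk : x' k = 0 := hL.apply_eq_zero hx' (by simp [hk])
  have hxij : x' i = x' j := hL.apply_eq_apply hx' (by simp [hi, hj])
  have hyk : y k = d' := by simpa [hxk] using hzk
  have hyi : y i = f d' := by
    have h1 := hL.rel_of_mem h3 hy hik.symm
    rw [hvk, hvi, hyk] at h1
    exact Rel.unique hL hd h1 (hf d d' hd)
  have hyj : y j = g d' := by
    have h1 := hL.rel_of_mem h3 hy hjk.symm
    rw [hvk, hvj, hyk] at h1
    exact Rel.unique hL hd h1 (hg d d' hd)
  have hzj : (x' + y) j = 0 := hL.apply_eq_zero hz (by simp [x, hj, hvj])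
  have hxj : x' j = -g d' := by
    rw [Pi.add_apply, hyj] at hzj
    exact eq_neg_of_add_eq_zero_left hzj
  have h1 := hL.rel_of_mem h3 hz hik.symm
  rw [hzk] at h1
  change Rel L d (f d - g d) d' (f d' - g d')
  simpa [x, hk, hi, hvk, hvi, hyi, hxij, hxj, sub_eq_add_neg, add_comm] using h1

/-- With all three coordinates in `s`, adding `d` on `s` to `(-d, g (-d), 0)` gives `(0, d - g d,
d)`, and splitting the points of its member yields only slopes `1 - g`. -/
theorem one_sub_mem_graphs_of_mem (hL : IsDiagonalSpread L) (h3 : 2 < Fintype.card ι)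
    (h0 : a₀ ≠ 0) (hN : IsNormalDirection L (s.piecewise (fun _ => a₀) 0)) {i j k : ι}
    (hij : i ≠ j) (hik : i ≠ k) (hjk : j ≠ k) (hi : i ∈ s) (hj : j ∈ s) (hk : k ∈ s)
    (hg : g ∈ graphs L) : 1 - g ∈ graphs L := by
  have : Nontrivial ι := Fintype.one_lt_card_iff_nontrivial.1 (by omega)
  intro d d' hd
  let v : ι → A := Pi.single i (-d) + Pi.single j (g (-d))
  have hvi : v i = -d := by simp [v, hij]
  have hvj : v j = g (-d) := by simp [v, hij.symm]
  have hvk : v k = 0 := by simp [v, hik.symm, hjk.symm]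
  let x : ι → A := s.piecewise (fun _ => d) 0
  obtain ⟨z, hz, hzk⟩ := hL.exists_apply_eq (v := x + v) (i := k) (by simpa [x, hk, hvk]) d'
  obtain ⟨x', hx', y, hy, rfl⟩ := AddSubgroup.mem_sup.1 (hN v _ (AddSubgroup.add_mem_sup
    (hL.piecewise_const_mem h0 d) (hL.spread.self_mem v)) hz)
  have hyk : y k = 0 := hL.apply_eq_zero hy hvk
  have hxk : x' k = d' := by simpa [hyk] using hzk
  have hxi : x' i = d' := by rw [← hxk]; exact hL.apply_eq_apply hx' (by simp [hi, hk])
  have hxj : x' j = d' := by rw [← hxk]; exact hL.apply_eq_apply hx' (by simp [hj, hk])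
  have hzi : (x' + y) i = 0 := hL.apply_eq_zero hz (by simp [x, hi, hvi])
  have hyi : y i = -d' := by
    rw [Pi.add_apply, hxi] at hzi
    exact eq_neg_of_add_eq_zero_right hzi
  have hyj : y j = g (-d') := by
    have h1 := hL.rel_of_mem h3 hy hij
    rw [hvi, hvj, hyi] at h1
    exact Rel.unique hL (neg_ne_zero.2 hd) h1 (hg _ _ (neg_ne_zero.2 hd))
  have h1 := hL.rel_of_mem h3 hz hjk.symm
  rw [hzk] at h1
  change Rel L d (d - g d) d' (d' - g d')
  simpa [x, hk, hj, hvk, hvj, hyj, hxj, sub_eq_add_neg] using h1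

/-- For `f ≠ 0`, transitivity of the slopes gives `u` with `f * u = g`, so `f - g = f * (1 - u)`.
For `f = 0` it remains to find the slope `-1`. -/
theorem sub_mem_graphs_of_one_sub (hL : IsDiagonalSpread L) (h3 : 2 < Fintype.card ι)
    (h1 : ∀ g ∈ graphs L, 1 - g ∈ graphs L) (hf : f ∈ graphs L) (hg : g ∈ graphs L) :
    f - g ∈ graphs L := by
  have : Nontrivial ι := Fintype.one_lt_card_iff_nontrivial.1 (by omega)
  cases subsingleton_or_nontrivial A with
  | inl h => exact fun a _ ha => (ha (Subsingleton.elim a 0)).elim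
  | inr h =>
    obtain ⟨a, ha⟩ := exists_ne (0 : A)
    have key : ∀ {f g}, f ∈ graphs L → g ∈ graphs L → f ≠ 0 → f - g ∈ graphs L := by
      intro f g hf hg hf0
      obtain ⟨b, hb⟩ := (Finite.injective_iff_surjective.1
        (hL.injective_of_mem_graphs h3 hf hf0)) (g a)
      obtain ⟨u, hu, hua⟩ := hL.exists_mem_graphs h3 ha b
      have : f * u = g := hL.eq_of_mem_graphs (hL.mul_mem_graphs h3 hf hu) hg ha
        ((congrArg f hua).trans hb)
      rw [← this, show f - f * u = f * (1 - u) by rw [mul_sub, mul_one]]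
      exact hL.mul_mem_graphs h3 hf (h1 u hu)
    -- In exponent two `-1 = 1`. Otherwise a slope `u` with `u b = -b`, `b + b ≠ 0`, is neither `0`
    -- nor `1`, and `-1 = (u - 1) - u` uses only differences with nonzero first term.
    have hneg : -1 ∈ graphs L := by
      by_cases h2 : ∀ a : A, a + a = 0
      · have : (-1 : AddMonoid.End A) = 1 := by
          ext a
          exact neg_eq_of_add_eq_zero_left (h2 a)
        rw [this]
        exact hL.one_mem_graphs h3
      · push Not at h2
        obtain ⟨b, hb⟩ := h2
        have hb0 : b ≠ 0 := by rintro rfl; simp at hb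
        obtain ⟨u, hu, hub⟩ := hL.exists_mem_graphs h3 hb0 (-b)
        have hu0 : u ≠ 0 := by
          rintro rfl
          exact hb0 (by simpa using hub.symm)
        have hu1 : u - 1 ≠ 0 := by
          intro h
          rw [sub_eq_zero.1 h] at hub
          exact hb (by nth_rw 1 [show b = -b from hub]; simp)
        have := key (key hu (hL.one_mem_graphs h3) hu0) hu hu1
        rwa [show u - 1 - u = -1 by abel] at this
    by_cases hf0 : f = 0
    · rw [hf0, zero_sub, ← neg_one_mul]
      exact hL.mul_mem_graphs h3 hneg hg
    · exact key hf hg hf0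

theorem sub_mem_graphs (hL : IsDiagonalSpread L) (h3 : 2 < Fintype.card ι)
    (h0 : a₀ ≠ 0) (hN : IsNormalDirection L (s.piecewise (fun _ => a₀) 0)) {i j : ι}
    (hij : i ≠ j) (hi : i ∈ s) (hj : j ∈ s)
    (hf : f ∈ graphs L) (hg : g ∈ graphs L) : f - g ∈ graphs L := by
  obtain ⟨k, hk⟩ := Finset.exists_mem_notMem_of_card_lt_card (s := {i, j}) (t := Finset.univ)
    (by rw [Finset.card_univ]; exact (Finset.card_le_two).trans_lt h3)
  simp only [Finset.mem_univ, true_and, Finset.mem_insert, Finset.mem_singleton, not_or] at hk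
  by_cases hks : k ∈ s
  · exact hL.sub_mem_graphs_of_one_sub h3 (fun g hg => hL.one_sub_mem_graphs_of_mem h3 h0 hN hij
      (Ne.symm hk.1) (Ne.symm hk.2) hi hj hks hg) hf hg
  · exact hL.sub_mem_graphs_of_notMem h3 h0 hN hij (Ne.symm hk.1) (Ne.symm hk.2) hi hj hks hf hg

end normal

/-! ### The coordinatising field -/

/-- The ring of endomorphisms whose graph is a member of the partition. -/
def graphRing (hL : IsDiagonalSpread L) (h3 : 2 < Fintype.card ι)
    (hsub : ∀ f ∈ graphs L, ∀ g ∈ graphs L, f - g ∈ graphs L) : Subring (AddMonoid.End A) where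
  carrier := graphs L
  mul_mem' hf hg := hL.mul_mem_graphs h3 hf hg
  one_mem' := hL.one_mem_graphs h3
  zero_mem' := hL.zero_mem_graphs h3
  neg_mem' {f} hf := by simpa using hsub 0 (hL.zero_mem_graphs h3) f hf
  add_mem' {f g} hf hg := by
    simpa using hsub f hf (0 - g) (hsub 0 (hL.zero_mem_graphs h3) g hg)

/-- Evaluation at a fixed nonzero `a` identifies the slope ring with `A`. Wedderburn's theorem makes
the slopes commute, so each acts coordinatewise as a scalar preserving every member. -/
theorem exists_field {A : Type} [AddCommGroup A] [Finite A] [Nontrivial A]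
    {L : (ι → A) → AddSubgroup (ι → A)} (hL : IsDiagonalSpread L)
    (h3 : 2 < Fintype.card ι)
    (hsub : ∀ f ∈ graphs L, ∀ g ∈ graphs L, f - g ∈ graphs L) :
    ∃ (E : Type) (_ : Field E) (_ : Finite E), Nat.card E = Nat.card A ∧
      ∃ g : (ι → A) ≃+ (ι → E), ∀ v w, w ∈ L v ↔ ∃ e : E, g w = e • g v := by
  have : Nontrivial ι := Fintype.one_lt_card_iff_nontrivial.1 (by omega)
  let R := hL.graphRing h3 hsub
  have : Finite R := Finite.of_injective (fun f : R => ((f : AddMonoid.End A) : A → A))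
    fun f g h => Subtype.ext (DFunLike.coe_injective h)
  obtain ⟨a, ha⟩ := exists_ne (0 : A)
  have : NoZeroDivisors R := by
    refine ⟨fun {f g} hfg => ?_⟩
    by_contra h
    push Not at h
    have h1 := hL.injective_of_mem_graphs h3 f.2 fun h' => h.1 (Subtype.ext h')
    have h2 := hL.injective_of_mem_graphs h3 g.2 fun h' => h.2 (Subtype.ext h')
    apply ha
    apply h2
    apply h1
    rw [map_zero, map_zero]
    exact DFunLike.congr_fun (congrArg Subtype.val hfg) a
  have : Nontrivial R := ⟨0, 1, fun h => ha (DFunLike.congr_fun (congrArg Subtype.val h) a).symm⟩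
  have : IsDomain R := NoZeroDivisors.to_isDomain R
  let hField : Field R := (Finite.isDomain_to_isField R).toField
  let τ : R ≃+ A := AddEquiv.ofBijective
    (AddMonoidHom.mk' (fun f : R => (f : AddMonoid.End A) a) fun f g => rfl)
    ⟨fun f g h => Subtype.ext (hL.eq_of_mem_graphs f.2 g.2 ha h), fun b => by
      obtain ⟨f, hf, hfb⟩ := hL.exists_mem_graphs h3 ha b
      exact ⟨⟨f, hf⟩, hfb⟩⟩
  have hτ : ∀ (e : R) (b : A), τ.symm ((e : AddMonoid.End A) b) = e * τ.symm b := by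
    intro e b
    apply τ.injective
    rw [AddEquiv.apply_symm_apply]
    conv_lhs => rw [← τ.apply_symm_apply b]
    rfl
  have hmul : ∀ e f : R, ∀ b, (e : AddMonoid.End A) ((f : AddMonoid.End A) b) =
      (f : AddMonoid.End A) ((e : AddMonoid.End A) b) := fun e f b =>
    DFunLike.congr_fun (congrArg Subtype.val (mul_comm e f)) b
  have hrel : ∀ (e : R) (b c : A), b ≠ 0 →
      Rel L b c ((e : AddMonoid.End A) b) ((e : AddMonoid.End A) c) := by
    intro e b c hb
    obtain ⟨f, hf, rfl⟩ := hL.exists_mem_graphs h3 hb c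
    rw [hmul e ⟨f, hf⟩ b]
    exact hf b _ hb
  have hmem : ∀ (e : R) (v : ι → A), (fun i => (e : AddMonoid.End A) (v i)) ∈ L v := by
    intro e v
    refine hL.mem_of_rel fun i j hij => ?_
    by_cases hi : v i = 0
    · by_cases hj : v j = 0
      · intro i' j' _
        simp [hi, hj]
      · exact (hrel e _ _ hj).symm
    · exact hrel e _ _ hi
  refine ⟨R, hField, inferInstance, Nat.card_congr τ.toEquiv,
    AddEquiv.piCongrRight fun _ => τ.symm, fun v w => ?_⟩
  have hiff : ∀ e : R, (AddEquiv.piCongrRight (fun _ : ι => τ.symm) w =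
      e • AddEquiv.piCongrRight (fun _ : ι => τ.symm) v) ↔
      w = fun i => (e : AddMonoid.End A) (v i) := by
    intro e
    rw [funext_iff, funext_iff]
    refine forall_congr' fun i => ?_
    rw [← τ.symm.injective.eq_iff, hτ]
    rfl
  simp only [hiff]
  constructor
  · intro hw
    by_cases hv : v = 0
    · refine ⟨0, ?_⟩
      rw [hv] at hw
      rw [hL.spread.eq_zero_of_mem_zero hw]
      rfl
    · obtain ⟨i, hi⟩ := Function.ne_iff.1 hv
      obtain ⟨f, hf, hfi⟩ := hL.exists_mem_graphs h3 hi (w i)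
      exact ⟨⟨f, hf⟩, hL.eq_of_apply_eq hw (hmem ⟨f, hf⟩ v) hi hfi.symm⟩
  · rintro ⟨e, rfl⟩
    exact hmem e v

end IsDiagonalSpread

/-! ### Transport along isomorphisms and internal direct sums -/

theorem IsSpreadMap.comap {V W : Type*} [AddCommGroup V] [AddCommGroup W] {L : V → AddSubgroup V}
    {Q : ℕ} (hL : IsSpreadMap L Q) (e : W ≃+ V) :
    IsSpreadMap (fun w => (L (e w)).comap (e : W →+ V)) Q where
  zero := by
    ext w
    simp [hL.zero]
  self_mem w := hL.self_mem (e w)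
  eq_of_mem {v w} h hw := by
    rw [hL.eq_of_mem (v := e v) (w := e w) h (by simpa using hw)]
  card w hw := by
    rw [← hL.card (e w) (by simpa using hw)]
    refine Nat.card_congr (e.toEquiv.subtypeEquiv fun x => Iff.rfl)

theorem IsNormalDirection.comap {V W : Type*} [AddCommGroup V] [AddCommGroup W]
    {L : V → AddSubgroup V} (e : W ≃+ V) {c : W} (hc : IsNormalDirection L (e c)) :
    IsNormalDirection (fun w => (L (e w)).comap (e : W →+ V)) c := by
  intro v u hu z hz
  obtain ⟨x, hx, y, hy, rfl⟩ := AddSubgroup.mem_sup.1 hu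
  have hxy : e (x + y) ∈ L (e c) ⊔ L (e v) := by
    rw [map_add]
    exact AddSubgroup.add_mem_sup hx hy
  obtain ⟨x', hx', y', hy', h⟩ := AddSubgroup.mem_sup.1 (hc (e v) _ hxy hz)
  refine AddSubgroup.mem_sup.2 ⟨e.symm x', by simpa using hx', e.symm y', by simpa using hy', ?_⟩
  rw [← map_add, h]
  exact e.symm_apply_apply z

section frame

variable {V ι : Type*} [AddCommGroup V] [Fintype ι] {U : ι → AddSubgroup V}

/-- The sum map of a family of subgroups. -/
def AddSubgroup.piSum (U : ι → AddSubgroup V) : (∀ i, U i) →+ V where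
  toFun x := ∑ i, (x i : V)
  map_zero' := by simp
  map_add' x y := by simp [Finset.sum_add_distrib]

variable (hU : Function.Bijective (AddSubgroup.piSum U))

/-- The projection on a summand of an internal direct sum. -/
noncomputable def summandProj (i : ι) : V →+ V :=
  ((U i).subtype.comp (Pi.evalAddMonoidHom (fun i => U i) i)).comp
    (AddEquiv.ofBijective (AddSubgroup.piSum U) hU).symm.toAddMonoidHom

theorem summandProj_mem (i : ι) (v : V) : summandProj hU i v ∈ U i :=
  ((AddEquiv.ofBijective (AddSubgroup.piSum U) hU).symm v i).2

theorem sum_summandProj (v : V) : ∑ i, summandProj hU i v = v :=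
  (AddEquiv.ofBijective (AddSubgroup.piSum U) hU).apply_symm_apply v

theorem summandProj_sum (x : ∀ i, U i) (i : ι) : summandProj hU i (∑ j, (x j : V)) = x i := by
  have : (AddEquiv.ofBijective (AddSubgroup.piSum U) hU).symm (∑ j, (x j : V)) = x :=
    (AddEquiv.ofBijective (AddSubgroup.piSum U) hU).symm_apply_apply x
  exact congrArg Subtype.val (congrFun this i)

theorem summandProj_of_mem_of_ne {i j : ι} (hij : j ≠ i) {x : V} (hx : x ∈ U i) :
    summandProj hU j x = 0 := by
  classical
  have h := summandProj_sum hU (Pi.single i ⟨x, hx⟩) j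
  rw [Finset.sum_eq_single i] at h
  · simpa [hij] using h
  · intro j _ hj; simp [hj]
  · simp

theorem summandProj_of_mem_iSup {s : Finset ι} {j : ι} (hj : j ∉ s) {x : V}
    (hx : x ∈ ⨆ i ∈ s, U i) : summandProj hU j x = 0 := by
  have : ⨆ i ∈ s, U i ≤ (summandProj hU j).ker :=
    iSup₂_le fun i hi y hy => summandProj_of_mem_of_ne hU (by rintro rfl; exact hj hi) hy
  exact this hx

theorem sum_summandProj_mem_iSup (s : Finset ι) (v : V) :
    ∑ i ∈ s, summandProj hU i v ∈ ⨆ i ∈ s, U i :=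
  sum_mem fun i hi => (le_iSup₂ (f := fun i (_ : i ∈ s) => U i) i hi) (summandProj_mem hU i v)

theorem sum_summandProj_of_mem_iSup [DecidableEq ι] {s : Finset ι} {x : V}
    (hx : x ∈ ⨆ i ∈ s, U i) : ∑ i ∈ s, summandProj hU i x = x := by
  nth_rw 2 [← sum_summandProj hU x]
  exact Finset.sum_subset (Finset.subset_univ s) fun i _ hi => summandProj_of_mem_iSup hU hi hx

end frame

/-! ### From a normal frame to coordinates over a field -/

section core

variable {V ι : Type*} [AddCommGroup V] [Fintype ι] [DecidableEq ι] {L : V → AddSubgroup V} {Q : ℕ}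
  {w : ι → V}

/-- If `u` is the projection of `v`, then `v` lies in the sum of the complementary summands and `L
u`, which is saturated. So `x` splits along this sum, and its part in `L u` is its projection. -/
theorem IsSpreadMap.sum_summandProj_mem (hL : IsSpreadMap L Q)
    (hw : ∀ i, IsNormalDirection L (w i))
    (hU : Function.Bijective (AddSubgroup.piSum fun i => L (w i))) (s : Finset ι) {v x : V}
    (hx : x ∈ L v) : ∑ i ∈ s, summandProj hU i x ∈ L (∑ i ∈ s, summandProj hU i v) := by
  set u := ∑ i ∈ s, summandProj hU i v with hu
  have hsat := hL.isSaturated_iSup_sup sᶜ (fun i _ => hw i) (hL.isSaturated u)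
  have hv : v ∈ (⨆ i ∈ sᶜ, L (w i)) ⊔ L u := by
    rw [← sum_summandProj hU v, ← Finset.sum_compl_add_sum s]
    exact AddSubgroup.add_mem_sup (sum_summandProj_mem_iSup hU _ v) (hL.self_mem u)
  obtain ⟨y, hy, z, hz, rfl⟩ := AddSubgroup.mem_sup.1 (hsat v hv hx)
  have hz' : z ∈ ⨆ i ∈ s, L (w i) :=
    hL.isSaturated_iSup s (fun i _ => hw i) u (sum_summandProj_mem_iSup hU s v) hz
  have : ∑ i ∈ s, summandProj hU i (y + z) = z := by
    simp only [map_add, Finset.sum_add_distrib]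
    rw [sum_summandProj_of_mem_iSup hU hz', Finset.sum_eq_zero, zero_add]
    exact fun i hi => summandProj_of_mem_iSup hU (by simpa using hi) hy
  rwa [this]

theorem IsSpreadMap.exists_field_of_isNormalDirection [Finite V] (hL : IsSpreadMap L Q)
    (h3 : 2 < Fintype.card ι) (hw0 : ∀ i, w i ≠ 0) (hw : ∀ i, IsNormalDirection L (w i))
    (hU : Function.Bijective (AddSubgroup.piSum fun i => L (w i))) {c : V}
    (hc : IsNormalDirection L c) (hcw : ∀ i, c ∉ L (w i)) :
    ∃ (E : Type) (_ : Field E) (_ : Finite E), Nat.card E = Q ∧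
      ∃ g : V ≃+ (ι → E), ∀ v x, x ∈ L v ↔ ∃ e : E, g x = e • g v := by
  classical
  have : Nontrivial ι := Fintype.one_lt_card_iff_nontrivial.1 (by omega)
  let π := summandProj hU
  -- The coordinates of `c`, with `w i` as default where `c` has coordinate zero: the diagonal must
  -- be nonzero in every coordinate and agree with `c` on its support.
  let d : ι → V := fun i => if π i c = 0 then w i else π i c
  have hd0 : ∀ i, d i ≠ 0 := by
    intro i
    by_cases h : π i c = 0
    · simp [d, h, hw0 i]
    · simp [d, h]
  have hdw : ∀ i, d i ∈ L (w i) := by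
    intro i
    by_cases h : π i c = 0
    · simpa [d, h] using hL.self_mem (w i)
    · simpa [d, h] using summandProj_mem hU i c
  have hπd : ∀ i, π i (∑ j, d j) = d i := fun i => summandProj_sum hU (fun i => ⟨d i, hdw i⟩) i
  set D := L (∑ j, d j) with hD
  have hd : ∑ j, d j ≠ 0 := by
    intro h
    obtain ⟨i⟩ := (inferInstance : Nonempty ι)
    exact hd0 i (by rw [← hπd i, h, map_zero])
  have hinj : ∀ x ∈ D, ∀ i, π i x = 0 → x = 0 := by
    intro x hx i hi
    by_contra hx0
    have h1 := hL.sum_summandProj_mem hw hU {i} (hL.mem_symm hx hx0)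
    rw [Finset.sum_singleton, Finset.sum_singleton] at h1
    change π i _ ∈ L (π i x) at h1
    rw [hi, hπd] at h1
    exact hd0 i (hL.eq_zero_of_mem_zero h1)
  -- The field is required to live in `Type`, while `V` may lie in any universe.
  let A := Shrink.{0} D
  let θ : A ≃+ D := Shrink.addEquiv
  have : Finite A := Finite.of_equiv _ θ.symm.toEquiv
  have hA : Nat.card A = Q := (Nat.card_congr θ.toEquiv).trans (hL.card _ hd)
  let ψ₀ : (ι → A) →+ V :=
    { toFun := fun a => ∑ i, π i (θ (a i))
      map_zero' := by simp
      map_add' := fun a b => by simp [Finset.sum_add_distrib] }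
  have hπψ : ∀ a i, π i (ψ₀ a) = π i (θ (a i)) := fun a i =>
    summandProj_sum hU (fun i => ⟨π i (θ (a i)), summandProj_mem hU i _⟩) i
  have hψinj : Function.Injective ψ₀ := by
    rw [injective_iff_map_eq_zero]
    intro a ha
    refine funext fun i => ?_
    have h1 := hinj _ (θ (a i)).2 i (by rw [← hπψ, ha, map_zero])
    exact θ.map_eq_zero_iff.1 (Subtype.ext h1)
  have hψ : Function.Bijective ψ₀ := by
    refine hψinj.bijective_of_nat_card_le ?_
    rw [← Nat.card_congr (Equiv.ofBijective _ hU), Nat.card_pi, Nat.card_pi]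
    exact (Finset.prod_congr rfl fun i _ => by rw [hA, hL.card _ (hw0 i)]).le
  let ψ : (ι → A) ≃+ V := AddEquiv.ofBijective ψ₀ hψ
  have hψconst : ∀ a : A, ψ (fun _ => a) = θ a := fun a => sum_summandProj hU (θ a : V)
  have hψpiece : ∀ (s : Finset ι) (a : ι → A), ψ (s.piecewise a 0) = ∑ i ∈ s, π i (ψ a) := by
    intro s a
    show ∑ i, π i (θ (s.piecewise a 0 i)) = ∑ i ∈ s, π i (ψ₀ a)
    rw [← Finset.sum_subset (Finset.subset_univ s)]
    · refine Finset.sum_congr rfl fun i hi => ?_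
      rw [hπψ, Finset.piecewise_eq_of_mem _ _ _ hi]
    · intro i _ hi
      simp [Finset.piecewise_eq_of_notMem _ _ _ hi]
  have hdiag : IsDiagonalSpread fun a => (L (ψ a)).comap (ψ : (ι → A) →+ V) := by
    refine ⟨hA ▸ hL.comap ψ, fun s a b hb => ?_, fun a b ha => ?_⟩
    · show ψ _ ∈ L (ψ _)
      rw [hψpiece, hψpiece]
      exact hL.sum_summandProj_mem hw hU s hb
    · show ψ _ ∈ L (ψ _)
      rw [hψconst, hψconst, hL.eq_of_mem (θ a).2 (by simpa using ha)]
      exact (θ b).2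
  let s : Finset ι := {i | π i c ≠ 0}
  let a₀ : A := θ.symm ⟨_, hL.self_mem _⟩
  have ha₀ : (θ a₀ : V) = ∑ j, d j := by simp [a₀]
  have ha₀0 : a₀ ≠ 0 := by
    intro h
    rw [h] at ha₀
    exact hd (by simpa using ha₀.symm)
  have hsum : ∑ i ∈ s, π i c = c := by
    rw [Finset.sum_filter_ne_zero]
    exact sum_summandProj hU c
  have hψc : ψ (s.piecewise (fun _ => a₀) 0) = c := by
    rw [hψpiece, hψconst, ha₀]
    refine Eq.trans ?_ hsum
    refine Finset.sum_congr rfl fun i hi => ?_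
    have hi' : π i c ≠ 0 := by simpa [s] using hi
    rw [hπd]
    simp [d, hi']
  -- If `c` had at most one nonzero coordinate, it would lie in a single summand.
  have hs : 1 < s.card := by
    by_contra hs
    obtain ⟨i, hi⟩ := Finset.card_le_one_iff_subset_singleton.1 (not_lt.1 hs)
    refine hcw i ?_
    rw [← hsum]
    refine sum_mem fun j hj => ?_
    rw [Finset.mem_singleton.1 (hi hj)]
    exact summandProj_mem hU i c
  obtain ⟨i, hi, j, hj, hij⟩ := Finset.one_lt_card.1 hs
  have : Nontrivial A := ⟨a₀, 0, ha₀0⟩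
  obtain ⟨E, hE, hfin, hcard, g, hg⟩ := hdiag.exists_field h3 fun f hf f' hf' =>
    hdiag.sub_mem_graphs h3 ha₀0 (IsNormalDirection.comap ψ (hψc.symm ▸ hc)) hij hi hj hf hf'
  refine ⟨E, hE, hfin, hcard.trans hA, ψ.symm.trans g, fun v x => ?_⟩
  have := hg (ψ.symm v) (ψ.symm x)
  rw [AddSubgroup.mem_comap] at this
  simpa using this

end core

/-! ### Recognising the affine space -/

theorem exists_span_singleton_of_finrank_eq_one {E M : Type*} [Field E] [AddCommGroup M]
    [Module E M] {W : Submodule E M} (hW : Module.finrank E W = 1) :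
    ∃ v, v ≠ 0 ∧ W = Submodule.span E {v} := by
  obtain ⟨⟨v, hv⟩, hv0, hspan⟩ := finrank_eq_one_iff'.1 hW
  refine ⟨v, fun h => hv0 (Subtype.ext h), le_antisymm (fun x hx => ?_)
    ((Submodule.span_singleton_le_iff_mem v W).2 hv)⟩
  obtain ⟨e, he⟩ := hspan ⟨x, hx⟩
  exact Submodule.mem_span_singleton.2 ⟨e, congrArg Subtype.val he⟩

namespace AddSubgroup

variable {V ι : Type*} [AddCommGroup V] [Fintype ι] {U : ι → AddSubgroup V}

theorem piSum_injective [DecidableEq ι]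
    (h : ∀ i, ∀ x ∈ U i, x ∈ ⨆ j ∈ Finset.univ.erase i, U j → x = 0) :
    Function.Injective (piSum U) := by
  rw [injective_iff_map_eq_zero]
  intro x hx
  ext i
  refine h i _ (x i).2 ?_
  have hx' : ∑ j, (x j : V) = 0 := hx
  rw [← Finset.add_sum_erase _ _ (Finset.mem_univ i)] at hx'
  rw [eq_neg_of_add_eq_zero_left hx']
  exact neg_mem (sum_mem fun j hj =>
    le_iSup₂ (f := fun j (_ : j ∈ Finset.univ.erase i) => U j) j hj (x j).2)

theorem le_range_piSum [DecidableEq ι] (i : ι) : U i ≤ (piSum U).range := by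
  intro x hx
  refine ⟨Pi.single i ⟨x, hx⟩, ?_⟩
  show ∑ j, _ = _
  rw [Finset.sum_eq_single i]
  · simp
  · intro j _ hj; simp [hj]
  · simp

end AddSubgroup

theorem SpernerSpace.card_eq {P : Type*} {v k : ℕ} (T : SpernerSpace P v k) : Nat.card P = v := by
  rw [← T.isDesign.2.1, Set.ncard_univ]

namespace IsCosetSpace

variable {P : Type*} [AddCommGroup P] {v k : ℕ} {T : SpernerSpace P v k} {L : P → AddSubgroup P}

theorem isIsomorphicToAG_of_addEquiv (hT : IsCosetSpace T L) {r : ℕ} {E : Type} [Field E]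
    [Finite E] (hE : Nat.card E = k) (g : P ≃+ (Fin r → E))
    (hg : ∀ v x, x ∈ L v ↔ ∃ e : E, g x = e • g v) : T.IsIsomorphicToAG r k := by
  have hL : ∀ w, L w = (Submodule.span E {g w}).toAddSubgroup.comap (g : P →+ (Fin r → E)) := by
    intro w
    ext x
    rw [hg]
    simp [Submodule.mem_span_singleton, eq_comm]
  have hspan : ∀ W : Submodule E (Fin r → E), Module.finrank E W = 1 ↔
      ∃ w, w ≠ 0 ∧ W = Submodule.span E {g w} := by
    intro W
    constructor
    · intro hW
      obtain ⟨u, hu, rfl⟩ := exists_span_singleton_of_finrank_eq_one hW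
      exact ⟨g.symm u, by simpa using hu, by simp⟩
    · rintro ⟨w, hw, rfl⟩
      exact finrank_span_singleton (by simpa using hw)
  refine ⟨E, inferInstance, inferInstance, hE, g.toEquiv, fun l => ?_, fun c => ?_⟩
  · rw [hT.mem_lines]
    constructor
    · rintro ⟨w, hw, a, ha⟩
      rw [hL] at ha
      exact ⟨_, (hspan _).2 ⟨w, hw, rfl⟩, g a, (g.image_eq_affineCoset_iff _ _ _).2 ha⟩
    · rintro ⟨W, hW, a, ha⟩
      obtain ⟨w, hw, rfl⟩ := (hspan W).1 hW
      obtain ⟨a, rfl⟩ := g.surjective a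
      refine ⟨w, hw, a, ?_⟩
      rw [hL]
      exact (g.image_eq_affineCoset_iff _ _ _).1 ha
  · rw [hT.mem_classes]
    constructor
    · rintro ⟨w, hw, rfl⟩
      rw [hL]
      exact ⟨_, (hspan _).2 ⟨w, hw, rfl⟩, (g.setOf_affineCoset_eq_image _).symm⟩
    · rintro ⟨W, hW, hc⟩
      obtain ⟨w, hw, rfl⟩ := (hspan W).1 hW
      refine ⟨w, hw, ?_⟩
      rw [hL]
      rw [g.setOf_affineCoset_eq_image] at hc
      exact g.injective.image_injective.image_injective hc

theorem isIsomorphicToAG [Finite P] (hT : IsCosetSpace T L) {r : ℕ} (hr : 2 < r) {w : Fin r → P}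
    (hw0 : ∀ i, w i ≠ 0) (hw : ∀ i, IsNormalDirection L (w i))
    (hU : Function.Bijective (AddSubgroup.piSum fun i => L (w i))) {c : P}
    (hc : IsNormalDirection L c) (hcw : ∀ i, c ∉ L (w i)) : T.IsIsomorphicToAG r k := by
  obtain ⟨E, _, _, hE, g, hg⟩ := hT.spread.exists_field_of_isNormalDirection
    (by simpa using hr) hw0 hw hU hc hcw
  exact hT.isIsomorphicToAG_of_addEquiv hE g hg

theorem card_pi (hT : IsCosetSpace T L) {r : ℕ} {w : Fin r → P} (hw0 : ∀ i, w i ≠ 0) :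
    Nat.card (∀ i, L (w i)) = k ^ r := by
  rw [Nat.card_pi, Finset.prod_congr rfl fun i _ => hT.spread.card _ (hw0 i)]
  simp

theorem isIsomorphicToAG_of_iSup_eq_top [Finite P] (hT : IsCosetSpace T L) {r : ℕ} (hr : 2 < r)
    (hv : v = k ^ r) {w : Fin r → P} (hw0 : ∀ i, w i ≠ 0) (hw : ∀ i, IsNormalDirection L (w i))
    (htop : ⨆ i, L (w i) = ⊤) {c : P} (hc : IsNormalDirection L c) (hcw : ∀ i, c ∉ L (w i)) :
    T.IsIsomorphicToAG r k := by
  refine hT.isIsomorphicToAG hr hw0 hw (Function.Surjective.bijective_of_nat_card_le ?_ ?_) hc hcw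
  · rw [← AddMonoidHom.range_eq_top, eq_top_iff, ← htop]
    exact iSup_le fun i => AddSubgroup.le_range_piSum (U := fun i => L (w i)) i
  · rw [hT.card_pi hw0, T.card_eq, hv]

/-- Directions of the members of a set of normal lines through `0`. -/
structure Directions (T : SpernerSpace P v k) (L : P → AddSubgroup P) {ι : Type*} (w : ι → P) :
    Prop where
  ne_zero : ∀ i, w i ≠ 0
  isNormal : ∀ i, IsNormalDirection L (w i)
  manifold_insert : ∀ i, ∀ x ∉ L (w i), T.manifold (insert x (L (w i) : Set P)) = ↑(L (w i) ⊔ L x)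
  notMem : ∀ i j, i ≠ j → w i ∉ L (w j)

theorem exists_directions [Finite P] (hT : IsCosetSpace T L) {N : Set (Set P)} {m : ℕ}
    (hm : N.ncard = m) (hN : T.AreNormalLinesThrough 0 N) :
    ∃ w : Fin m → P, Directions T L w ∧ N = Set.range fun i => (L (w i) : Set P) := by
  have hfin : N.Finite := Set.toFinite N
  let e : N ≃ Fin m := Finite.equivFinOfCardEq (by rwa [Nat.card_coe_set_eq])
  have h := fun i => hT.exists_of_isNormalLine (hN _ (e.symm i).2).1 (hN _ (e.symm i).2).2
  choose w hw0 hwe hwn hwm using h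
  refine ⟨w, ⟨hw0, hwn, hwm, fun i j hij hmem => hij ?_⟩, ?_⟩
  · apply e.symm.injective
    apply Subtype.ext
    rw [hwe, hwe, hT.spread.eq_of_mem hmem (hw0 i)]
  · ext l
    constructor
    · intro hl
      exact ⟨e ⟨l, hl⟩, by simp [← hwe]⟩
    · rintro ⟨i, rfl⟩
      simp only [← hwe]
      exact (e.symm i).2

theorem isIsomorphicToAG_of_inGeneralPosition [Finite P] (hT : IsCosetSpace T L) {r : ℕ}
    (hr : 2 < r) (hv : v = k ^ r) {N : Set (Set P)} (hcard : N.ncard = r + 1)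
    (hN : T.AreNormalLinesThrough 0 N) (hgen : T.InGeneralPosition r 0 N) :
    T.IsIsomorphicToAG r k := by
  obtain ⟨w, hw, rfl⟩ := hT.exists_directions hcard hN
  refine hT.isIsomorphicToAG hr (w := fun i => w i.castSucc) (fun i => hw.ne_zero _)
    (fun i => hw.isNormal _) (Function.Injective.bijective_of_nat_card_le ?_ ?_)
    (hw.isNormal (Fin.last r)) fun i => hw.notMem _ _ (Fin.castSucc_lt_last i).ne'
  · refine AddSubgroup.piSum_injective fun i x hx hx' => ?_
    -- General position is applied to the `r - 1` other lines of the frame, the largest number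
    -- allowed; this makes the sum direct. The last of the `r + 1` lines is the extra direction.
    let s : Finset (Fin r) := Finset.univ.erase i
    have hs : s.card = r - 1 := by simp [s]
    have hne : s.Nonempty := Finset.card_pos.1 (by omega)
    have hman := hT.manifold_iUnion (w := fun i : Fin r => w i.castSucc) hne
      (fun i _ => hw.isNormal _) fun i _ => hw.manifold_insert _
    let f : Fin r → Set P := fun j => (L (w j.castSucc) : Set P)
    have h1 := hgen _ ⟨i.castSucc, rfl⟩ (f '' s) ?_ (Set.toFinite _) (hne.to_set.image f) ?_
    · rw [Set.sUnion_image] at h1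
      have h2 : x ∈ (L (w i.castSucc) : Set P) ∩ T.manifold (⋃ j ∈ (s : Set (Fin r)), f j) := by
        refine ⟨hx, ?_⟩
        simp only [Finset.mem_coe, f]
        rw [hman]
        exact hx'
      rw [h1] at h2
      exact h2
    · rintro _ ⟨j, hj, rfl⟩
      refine ⟨⟨_, rfl⟩, fun h => ?_⟩
      have hji : j ≠ i := Finset.ne_of_mem_erase hj
      refine hw.notMem j.castSucc i.castSucc (fun h => hji (Fin.castSucc_injective r h)) ?_
      have h' : f j = (L (w i.castSucc) : Set P) := h
      have : w j.castSucc ∈ f j := hT.spread.self_mem _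
      rwa [h'] at this
    · exact (Set.ncard_image_le (Set.toFinite _)).trans (by rw [Set.ncard_coe_finset, hs])
  · rw [hT.card_pi fun i => hw.ne_zero _, T.card_eq, hv]

theorem isIsomorphicToAG_of_manifold_eq_univ [Finite P] (hT : IsCosetSpace T L) {r : ℕ}
    (hr : 2 < r) (hv : v = k ^ r) {N N' : Set (Set P)} (hcard : r + 1 ≤ N.ncard)
    (hN : T.AreNormalLinesThrough 0 N) (hN' : N' ⊆ N) (hcard' : N'.ncard = r)
    (huniv : T.manifold (⋃₀ N') = Set.univ) : T.IsIsomorphicToAG r k := by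
  obtain ⟨l, hl, hlN'⟩ := Set.exists_mem_notMem_of_ncard_lt_ncard (s := N') (t := N)
    (by omega)
  obtain ⟨c, hc0, rfl, hc, -⟩ := hT.exists_of_isNormalLine (hN l hl).1 (hN l hl).2
  obtain ⟨w, hw, rfl⟩ := hT.exists_directions hcard' fun l hl => hN l (hN' hl)
  have : NeZero r := ⟨by omega⟩
  have hman := hT.manifold_iUnion (w := w) Finset.univ_nonempty
    (fun i _ => hw.isNormal i) fun i _ => hw.manifold_insert i
  refine hT.isIsomorphicToAG_of_iSup_eq_top hr hv hw.ne_zero hw.isNormal ?_ hc fun i hi => ?_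
  · rw [Set.sUnion_range] at huniv
    simp only [Finset.mem_univ, Set.iUnion_true, iSup_true] at hman
    rw [huniv] at hman
    exact (AddSubgroup.coe_eq_univ.1 hman.symm)
  · exact hlN' ⟨i, by simp only [hT.spread.eq_of_mem hi hc0]⟩

theorem isIsomorphicToAG_of_not_coplanar [Finite P] (hT : IsCosetSpace T L) (hv : v = k ^ 3)
    {N : Set (Set P)} (hcard : N.ncard = 4) (hN : T.AreNormalLinesThrough 0 N)
    (hplane : ¬ ∃ E : Set P, T.IsAffinePlane E ∧ ∀ l ∈ N, l ⊆ E) : T.IsIsomorphicToAG 3 k := by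
  obtain ⟨w, hw, rfl⟩ := hT.exists_directions hcard hN
  have h10 : w 1 ∉ L (w 0) := hw.notMem 1 0 (by decide)
  have hplane' : ∃ i, w i ∉ L (w 0) ⊔ L (w 1) := by
    by_contra h
    push Not at h
    refine hplane ⟨_, (hN _ ⟨0, rfl⟩).1.2 _ h10, ?_⟩
    rintro _ ⟨i, rfl⟩
    rw [hw.manifold_insert 0 _ h10]
    exact hw.isNormal 0 (w 1) (w i) (h i)
  obtain ⟨i, hi⟩ := hplane'
  have hi0 : i ≠ 0 := by
    rintro rfl
    exact hi (AddSubgroup.mem_sup_left (hT.spread.self_mem _))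
  have hi1 : i ≠ 1 := by
    rintro rfl
    exact hi (AddSubgroup.mem_sup_right (hT.spread.self_mem _))
  -- Directions `0`, `1`, `i` span by counting; the remaining one, `j`, is the extra direction.
  obtain ⟨j, hj0, hj1, hji⟩ : ∃ j : Fin 4, j ≠ 0 ∧ j ≠ 1 ∧ j ≠ i := by
    exact (by decide : ∀ i : Fin 4, ∃ j : Fin 4, j ≠ 0 ∧ j ≠ 1 ∧ j ≠ i) i
  refine hT.isIsomorphicToAG_of_iSup_eq_top (by norm_num) hv (w := fun m => w (![0, 1, i] m))
    (fun m => hw.ne_zero _) (fun m => hw.isNormal _) ?_ (hw.isNormal j) fun m => hw.notMem _ _ ?_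
  · have hle : L (w 0) ⊔ L (w 1) ⊔ L (w i) ≤ ⨆ m : Fin 3, L (w (![0, 1, i] m)) :=
      sup_le (sup_le (le_iSup (fun m : Fin 3 => L (w (![0, 1, i] m))) 0)
        (le_iSup (fun m : Fin 3 => L (w (![0, 1, i] m))) 1))
        (le_iSup (fun m : Fin 3 => L (w (![0, 1, i] m))) 2)
    refine eq_top_iff.2 (le_trans (AddSubgroup.eq_top_of_card_eq _ ?_).ge hle)
    rw [hT.spread.card_sup (hw.isNormal 0 (w 1)) hi,
      hT.spread.card_sup (hT.spread.isSaturated _) h10, hT.spread.card _ (hw.ne_zero 0),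
      T.card_eq, hv]
    ring
  · fin_cases m <;> simp [hj0, hj1, hji]

end IsCosetSpace

/-! ### Semifield planes from a biadditive multiplication -/

section semifield

variable {Q : Type*} [AddCommGroup Q]

/-- The nonassociative ring structure given by a biadditive multiplication with identity. -/
abbrev nonAssocRingOfMul (m : Q →+ Q →+ Q) (e : Q) (he : ∀ x, m e x = x) (he' : ∀ x, m x e = x) :
    NonAssocRing Q :=
  { (inferInstance : AddCommGroup Q) with
    mul := fun x y => m x y
    one := e
    left_distrib := fun x y z => map_add (m x) y z
    right_distrib := fun x y z => DFunLike.congr_fun (map_add m x y) z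
    zero_mul := fun x => DFunLike.congr_fun (map_zero m) x
    mul_zero := fun x => map_zero (m x)
    one_mul := he
    mul_one := he' }

theorem isSemifield_nonAssocRingOfMul [Finite Q] {m : Q →+ Q →+ Q} {e : Q} (h0 : e ≠ 0)
    (he : ∀ x, m e x = x) (he' : ∀ x, m x e = x) (hm : ∀ x y, m x y = 0 → x = 0 ∨ y = 0) :
    @IsSemifield Q (nonAssocRingOfMul m e he he') := by
  refine ⟨inferInstance, ⟨e, 0, h0⟩, fun a b ha => ⟨?_, ?_⟩⟩
  · have : Function.Injective (m a) :=
      (injective_iff_map_eq_zero _).2 fun x hx => (hm a x hx).resolve_left ha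
    exact (Finite.injective_iff_bijective.1 this).existsUnique b
  · have : Function.Injective (m.flip a) :=
      (injective_iff_map_eq_zero _).2 fun x hx => (hm x a hx).resolve_right ha
    exact (Finite.injective_iff_bijective.1 this).existsUnique b

end semifield

namespace IsCosetSpace

variable {P : Type*} [AddCommGroup P] {v k : ℕ} {T : SpernerSpace P v k} {L : P → AddSubgroup P}

/-- The product is `x * y = μ (h x) y`, where `h` inverts `δ ↦ μ δ a`, so that `a` is a right
identity. It is also a left identity, since `h a = d` and `μ d α = α`. Cosets of `L a` are the
vertical lines and cosets of `L (d + α)` those of slope `α`. -/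
theorem isAffineSemifieldPlane [Finite P] (hT : IsCosetSpace T L) {a d : P} (ha0 : a ≠ 0)
    (ha : IsNormalDirection L a) (hd : d ∉ L a) {μ : L d → L a → L a}
    (hμ : ∀ (δ : L d) (α α' : L a), (δ : P) + α' ∈ L (d + α) ↔ α' = μ δ α)
    (hadd : ∀ δ α α', μ δ (α + α') = μ δ α + μ δ α')
    (hE : T.IsAffinePlane ↑(L a ⊔ L d)) : T.IsAffineSemifieldPlane ↑(L a ⊔ L d) := by
  have hL := hT.spread
  have hd0 : d ≠ 0 := fun h => hd (h ▸ (L a).zero_mem)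
  have hdisj : ∀ x ∈ L a, x ∈ L d → x = 0 := fun x hx hxd =>
    hL.eq_zero_of_mem (hL.isSaturated a) hd hx hxd
  let d' : L d := ⟨d, hL.self_mem d⟩
  let a' : L a := ⟨a, hL.self_mem a⟩
  have hμd : ∀ α, μ d' α = α := fun α => ((hμ d' α α).1 (hL.self_mem _)).symm
  have hadd' : ∀ δ δ' α, μ (δ + δ') α = μ δ α + μ δ' α := by
    intro δ δ' α
    refine ((hμ _ _ _).1 ?_).symm
    have := (L (d + α)).add_mem ((hμ δ α _).2 rfl) ((hμ δ' α _).2 rfl)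
    convert this using 1
    push_cast
    abel
  have hμ0 : ∀ δ α, μ δ α = 0 → δ = 0 ∨ α = 0 := by
    intro δ α h
    by_contra hne
    push Not at hne
    have hδ : (δ : P) ≠ 0 := fun h' => hne.1 (Subtype.ext h')
    have h1 : (δ : P) ∈ L (d + α) := by simpa using (hμ δ α 0).2 h.symm
    have h2 : L (d + α) = L d := hL.eq_of_mem_of_mem h1 δ.2 hδ
    have h3 : (α : P) ∈ L d := by
      rw [← (L d).add_mem_cancel_left (hL.self_mem d), ← h2]
      exact hL.self_mem _
    exact hne.2 (Subtype.ext (hdisj _ α.2 h3))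
  let M : L d →+ L a →+ L a := AddMonoidHom.mk' (fun δ => AddMonoidHom.mk' (μ δ) (hadd δ))
    fun δ δ' => AddMonoidHom.ext (hadd' δ δ')
  have hMinj : Function.Injective (M.flip a') := by
    refine (injective_iff_map_eq_zero _).2 fun δ hδ => (hμ0 δ a' hδ).resolve_right fun h => ?_
    exact ha0 (congrArg Subtype.val h)
  have hMbij := hMinj.bijective_of_nat_card_le (by rw [hL.card a ha0, hL.card d hd0])
  let h : L a ≃+ L d := (AddEquiv.ofBijective _ hMbij).symm
  have hh : ∀ α, μ (h α) a' = α := (AddEquiv.ofBijective _ hMbij).apply_symm_apply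
  have hha : h a' = d' := by
    apply h.symm.injective
    rw [h.symm_apply_apply]
    exact (hμd a').symm
  let Q := Shrink.{0} (L a)
  let σ : Q ≃+ L a := Shrink.addEquiv
  have : Finite Q := Finite.of_equiv _ σ.symm.toEquiv
  let m : Q →+ Q →+ Q := AddMonoidHom.mk'
    (fun x => σ.symm.toAddMonoidHom.comp ((M (h (σ x))).comp σ.toAddMonoidHom)) fun x y => by
      ext z
      simp
  have hm : ∀ x y, σ (m x y) = μ (h (σ x)) (σ y) := fun x y => σ.apply_symm_apply _
  have he : ∀ x, m (σ.symm a') x = x := by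
    intro x
    apply σ.injective
    rw [hm, σ.apply_symm_apply, hha, hμd]
  have he' : ∀ x, m x (σ.symm a') = x := by
    intro x
    apply σ.injective
    rw [hm, σ.apply_symm_apply, hh]
  have hm0 : ∀ x y, m x y = 0 → x = 0 ∨ y = 0 := by
    intro x y hxy
    have := hm x y
    rw [hxy, map_zero] at this
    simpa using hμ0 _ _ this.symm
  let f : Q × Q → P := fun z => h (σ z.1) + σ z.2
  have hf : Function.Injective f := by
    rintro ⟨x, y⟩ ⟨x', y'⟩ hxy
    have h1 : ((h (σ x) : P)) + σ y = h (σ x') + σ y' := hxy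
    have h2 : (σ y : P) - σ y' = h (σ x') - h (σ x) := by
      rw [sub_eq_sub_iff_add_eq_add, add_comm, h1, add_comm]
    have h3 := hdisj _ ((L a).sub_mem (σ y).2 (σ y').2)
      (h2 ▸ (L d).sub_mem (h (σ x')).2 (h (σ x)).2)
    rw [h3] at h2
    rw [sub_eq_zero] at h3
    have h4 := Subtype.ext (sub_eq_zero.1 h2.symm)
    rw [σ.injective (Subtype.ext h3), σ.injective (h.injective h4)]
  have hsurj : ∀ δ ∈ L d, ∀ α ∈ L a, ∃ z, f z = δ + α := by
    intro δ hδ α hα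
    exact ⟨⟨σ.symm (h.symm ⟨δ, hδ⟩), σ.symm ⟨α, hα⟩⟩, by simp [f]⟩
  have hrange : Set.range f = ↑(L a ⊔ L d) := by
    ext x
    constructor
    · rintro ⟨z, rfl⟩
      exact add_mem (AddSubgroup.mem_sup_right (h (σ z.1)).2)
        (AddSubgroup.mem_sup_left (σ z.2).2)
    · intro hx
      obtain ⟨α, hα, δ, hδ, rfl⟩ := AddSubgroup.mem_sup.1 hx
      rw [add_comm]
      exact hsurj δ hδ α hα
  have hvert : ∀ x₀ y₀, f '' {z | z.1 = x₀} = {p | p - f (x₀, y₀) ∈ L a} := by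
    intro x₀ y₀
    ext p
    constructor
    · rintro ⟨⟨x, y⟩, rfl, rfl⟩
      show (h (σ x) : P) + σ y - (h (σ x) + σ y₀) ∈ L a
      rw [add_sub_add_left_eq_sub]
      exact (L a).sub_mem (σ y).2 (σ y₀).2
    · intro hp
      have hp' : p - f (x₀, y₀) ∈ L a := hp
      refine ⟨⟨x₀, σ.symm ⟨p - f (x₀, y₀), hp'⟩ + y₀⟩, rfl, ?_⟩
      simp [f]
      abel
  have hslope : ∀ x₀ m₀ b₀, f '' {z | z.2 = m z.1 m₀ + b₀} =
      {p | p - f (x₀, m x₀ m₀ + b₀) ∈ L (d + σ m₀)} := by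
    intro x₀ m₀ b₀
    have hgr : ∀ x, (h (σ x) : P) + σ (m x m₀) ∈ L (d + σ m₀) := by
      intro x
      rw [hm]
      exact (hμ _ _ _).2 rfl
    have hle : L (d + σ m₀) ≤ L a ⊔ L d := ha d _ (by
      rw [add_comm]
      exact AddSubgroup.add_mem_sup (σ m₀).2 (hL.self_mem d))
    ext p
    constructor
    · rintro ⟨⟨x, y⟩, hxy, rfl⟩
      have hxy' : y = m x m₀ + b₀ := hxy
      show (h (σ x) : P) + σ y - (h (σ x₀) + σ (m x₀ m₀ + b₀)) ∈ L (d + σ m₀)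
      convert (L (d + σ m₀)).sub_mem (hgr x) (hgr x₀) using 1
      rw [hxy']
      push_cast [map_add]
      abel
    · intro hp
      have hp' : p - f (x₀, m x₀ m₀ + b₀) ∈ L (d + σ m₀) := hp
      have hpE : p ∈ Set.range f := by
        have h1 : f (x₀, m x₀ m₀ + b₀) ∈ Set.range f := ⟨_, rfl⟩
        rw [hrange] at h1 ⊢
        simpa using (L a ⊔ L d).add_mem (hle hp') h1
      obtain ⟨⟨x, y⟩, rfl⟩ := hpE
      refine ⟨(x, y), ?_, rfl⟩
      have h1 := (L (d + σ m₀)).add_mem hp' (hgr x₀)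
      have h2 : (h (σ x) : P) + (σ (y - b₀) : L a) ∈ L (d + σ m₀) := by
        convert h1 using 1
        simp only [f]
        push_cast [map_add, map_sub]
        abel
      rw [hμ, ← hm, σ.injective.eq_iff] at h2
      exact sub_eq_iff_eq_add.1 h2
  refine ⟨hE, Q, nonAssocRingOfMul m _ he he', isSemifield_nonAssocRingOfMul (fun h => ha0 ?_)
    he he' hm0, f, hf, hrange, fun l => ⟨?_, fun hl => ?_⟩⟩
  · exact congrArg Subtype.val (σ.symm.map_eq_zero_iff.1 h)
  · rintro (⟨x₀, rfl⟩ | ⟨m₀, b₀, rfl⟩)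
    · rw [hvert x₀ 0]
      exact hT.coset_mem_lines ha0 _
    · refine (hslope 0 m₀ b₀).symm ▸ hT.coset_mem_lines (fun h => hd ?_) _
      rw [eq_neg_of_add_eq_zero_left h]
      exact neg_mem (σ m₀).2
  · obtain ⟨u, hu, p, hp⟩ := (hT.mem_lines _).1 hl
    have hmem : ∀ y, y - p ∈ L u → y ∈ Set.range f := by
      intro y hy
      have : y ∈ f '' l := hp ▸ hy
      obtain ⟨z, -, rfl⟩ := this
      exact ⟨z, rfl⟩
    obtain ⟨⟨x₀, y₀⟩, rfl⟩ := hmem p (by simp)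
    have huE : u ∈ L a ⊔ L d := by
      have h1 := hmem (u + f (x₀, y₀)) (by simpa using hL.self_mem u)
      have h2 : f (x₀, y₀) ∈ Set.range f := ⟨_, rfl⟩
      rw [hrange] at h1 h2
      simpa using (L a ⊔ L d).sub_mem h1 h2
    by_cases hua : u ∈ L a
    · left
      refine ⟨x₀, hf.image_injective ?_⟩
      rw [hp, hvert x₀ y₀, hL.eq_of_mem hua hu]
    · right
      obtain ⟨α, hα, δ, hδ, rfl⟩ := AddSubgroup.mem_sup.1 huE
      have hδ0 : δ ≠ 0 := by
        rintro rfl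
        exact hua (by simpa using hα)
      have hδu : δ ∈ L a ⊔ L (α + δ) := by
        have := AddSubgroup.add_mem_sup (neg_mem hα) (hL.self_mem (α + δ))
        simpa using this
      -- A non-vertical member of the plane meets the coset `d + L a`, and the meeting point gives
      -- its slope.
      have hdu : d ∈ L a ⊔ L (α + δ) := ha _ δ hδu (hL.mem_symm hδ hδ0)
      obtain ⟨α', hα', y, hy, hy'⟩ := AddSubgroup.mem_sup.1 hdu
      have hyd : y = d + σ (σ.symm ⟨-α', neg_mem hα'⟩) := by
        rw [σ.apply_symm_apply, ← hy']
        show y = α' + y + -α'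
        abel
      have hy0 : y ≠ 0 := by
        rintro rfl
        exact hd (by simpa [← hy'] using hα')
      refine ⟨σ.symm ⟨-α', neg_mem hα'⟩, y₀ - m x₀ (σ.symm ⟨-α', neg_mem hα'⟩),
        hf.image_injective ?_⟩
      rw [hp]
      refine Eq.trans ?_ (hslope x₀ _ _).symm
      rw [← hyd, hL.eq_of_mem hy hy0, add_sub_cancel]

end IsCosetSpace

/-! ### Additivity from three coplanar normal directions -/

section shears

variable {V : Type*} [AddCommGroup V] {L : V → AddSubgroup V} {k : ℕ}

theorem IsSpreadMap.existsUnique_add_mem (hL : IsSpreadMap L k) {a d : V}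
    (ha : IsNormalDirection L a) (hd : d ∉ L a) (δ : L d) (α : L a) :
    ∃! α' : L a, (δ : V) + α' ∈ L (d + α) := by
  have h1 : d ∈ L a ⊔ L (d + α) := by
    simpa using AddSubgroup.add_mem_sup (neg_mem α.2) (hL.self_mem (d + α))
  obtain ⟨α₁, hα₁, x, hx, hδ⟩ := AddSubgroup.mem_sup.1 (ha _ d h1 δ.2)
  refine ⟨⟨-α₁, neg_mem hα₁⟩, ?_, fun α' hα' => ?_⟩
  · show (δ : V) + -α₁ ∈ L (d + α)
    rw [← hδ]
    simpa using hx
  · have h2 : (δ : V) + α' - x ∈ L (d + α) := (L _).sub_mem hα' hx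
    have h3 : (δ : V) + α' - x = α₁ + α' := by rw [← hδ]; abel
    rw [h3] at h2
    have h4 := hL.eq_zero_of_mem (hL.isSaturated a)
      (fun h => hd (((L a).add_mem_cancel_right α.2).1 h)) ((L a).add_mem hα₁ α'.2) h2
    exact Subtype.ext (eq_neg_of_add_eq_zero_right h4)

/-- The shears `μ` along `a` and `ν` along `b` together describe the member through `d + α + β`. If
`α' ≡ β` modulo `L c`, normality of `c` gives `μ δ (α + α') ≡ μ δ α + ν δ β` modulo `L c`.
Subtracting the case `α = 0` removes `ν`, and `L a` meets `L c` only in zero. -/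
theorem IsSpreadMap.exists_additive (hL : IsSpreadMap L k) {a b c d : V}
    (ha : IsNormalDirection L a) (hb : IsNormalDirection L b) (hc : IsNormalDirection L c)
    (hcab : c ∈ L a ⊔ L b) (hba : b ∉ L a) (hca : c ∉ L a) (hcb : c ∉ L b)
    (hd : d ∉ L a ⊔ L b) :
    ∃ μ : L d → L a → L a,
      (∀ (δ : L d) (α α' : L a), (δ : V) + α' ∈ L (d + α) ↔ α' = μ δ α) ∧
      ∀ δ α α', μ δ (α + α') = μ δ α + μ δ α' := by
  have hda : d ∉ L a := fun h => hd (AddSubgroup.mem_sup_left h)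
  have hdb : d ∉ L b := fun h => hd (AddSubgroup.mem_sup_right h)
  have hsat : IsSaturated L (L a ⊔ L b) := ha b
  have hdisj : ∀ x ∈ L a ⊔ L b, x ∈ L d → x = 0 := fun x hx hxd =>
    hL.eq_zero_of_mem hsat hd hx hxd
  have hab : ∀ x ∈ L a, x ∈ L b → x = 0 := fun x hx hxb =>
    hL.eq_zero_of_mem (hL.isSaturated a) hba hx hxb
  have hac : ∀ x ∈ L a, x ∈ L c → x = 0 := fun x hx hxc =>
    hL.eq_zero_of_mem (hL.isSaturated a) hca hx hxc
  choose μ hμ hμu using hL.existsUnique_add_mem ha hda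
  choose ν hν hνu using hL.existsUnique_add_mem hb hdb
  have hμiff : ∀ (δ : L d) (α α' : L a), (δ : V) + α' ∈ L (d + α) ↔ α' = μ δ α := fun δ α α' =>
    ⟨fun h => hμu δ α α' h, fun h => h ▸ hμ δ α⟩
  refine ⟨μ, hμiff, ?_⟩
  -- a member through `d + α + β` is determined by its two projections
  have hunique : ∀ (α : L a) (β : L b) (y y' : V), y ∈ L (d + α + β) → y' ∈ L (d + α + β) →
      y - y' ∈ L a ⊔ L b → y = y' := by
    intro α β y y' hy hy' hyy
    refine sub_eq_zero.1 (hL.eq_zero_of_mem hsat (fun h => hd ?_) hyy ((L _).sub_mem hy hy'))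
    have := (L a ⊔ L b).sub_mem h (AddSubgroup.add_mem_sup α.2 β.2)
    simpa [add_assoc] using this
  -- A point `x` of this member congruent to `δ` modulo `L a ⊔ L b` is projected along `L b` to `δ +
  -- μ δ α` and along `L a` to `δ + ν δ β`. Since `L a` and `L b` meet trivially, `x` is determined.
  have hμν : ∀ (δ : L d) (α : L a) (β : L b), (δ : V) + μ δ α + ν δ β ∈ L (d + α + β) := by
    intro δ α β
    have h1 : d ∈ L a ⊔ (L b ⊔ L (d + α + β)) := by
      have := AddSubgroup.add_mem_sup (neg_mem α.2)
        (AddSubgroup.add_mem_sup (neg_mem β.2) (hL.self_mem (d + α + β)))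
      convert this using 1
      abel
    obtain ⟨α₁, hα₁, z, hz, hδ⟩ := AddSubgroup.mem_sup.1
      (ha.isSaturated_sup (hb _) hL d h1 δ.2)
    obtain ⟨β₁, hβ₁, x, hx, rfl⟩ := AddSubgroup.mem_sup.1 hz
    have h2 : d + α + β ∈ L b ⊔ L (d + α) := by
      rw [add_comm (d + (α : V)) (β : V)]
      exact AddSubgroup.add_mem_sup β.2 (hL.self_mem _)
    obtain ⟨β₂, hβ₂, y, hy, hxy⟩ := AddSubgroup.mem_sup.1 (hb _ _ h2 hx)
    have h3 : d + α + β ∈ L a ⊔ L (d + β) := by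
      rw [show d + α + β = α + (d + β) by abel]
      exact AddSubgroup.add_mem_sup α.2 (hL.self_mem _)
    obtain ⟨α₃, hα₃, y', hy', hxy'⟩ := AddSubgroup.mem_sup.1 (ha _ _ h3 hx)
    have hyp : y - δ ∈ L a ⊔ L b := by
      have : y - δ = -α₁ + -(β₁ + β₂) := by rw [← hδ, ← hxy]; abel
      rw [this]
      exact AddSubgroup.add_mem_sup (neg_mem hα₁) (neg_mem (add_mem hβ₁ hβ₂))
    have hyp' : y' - δ ∈ L a ⊔ L b := by
      have : y' - δ = -(α₁ + α₃) + -β₁ := by rw [← hδ, ← hxy']; abel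
      rw [this]
      exact AddSubgroup.add_mem_sup (neg_mem (add_mem hα₁ hα₃)) (neg_mem hβ₁)
    have e1 : y = δ + μ δ α := by
      have := hunique α 0 y (δ + μ δ α) (by simpa using hy) (by simpa using hμ δ α) ?_
      · exact this
      · rw [sub_add_eq_sub_sub]
        exact (L a ⊔ L b).sub_mem hyp (AddSubgroup.mem_sup_left (μ δ α).2)
    have e2 : y' = δ + ν δ β := by
      have := hunique 0 β y' (δ + ν δ β) (by simpa using hy') (by simpa using hν δ β) ?_
      · exact this
      · rw [sub_add_eq_sub_sub]
        exact (L a ⊔ L b).sub_mem hyp' (AddSubgroup.mem_sup_right (ν δ β).2)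
    have e3 : (μ δ α : V) - α₃ = ν δ β - β₂ := by
      rw [← hxy', e1, e2] at hxy
      rw [sub_eq_sub_iff_add_eq_add]
      have : β₂ + ((δ : V) + μ δ α) - δ = α₃ + (δ + ν δ β) - δ := by rw [hxy]
      convert this using 1 <;> abel
    have e4 := hab _ ((L a).sub_mem (μ δ α).2 hα₃) (e3 ▸ (L b).sub_mem (ν δ β).2 hβ₂)
    rw [e4] at e3
    have e5 : (ν δ β : V) = β₂ := sub_eq_zero.1 e3.symm
    convert hx using 1
    rw [← hxy, e1, e5]
    abel
  have hCle : L c ≤ L a ⊔ L b := hsat c hcab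
  have hAle : L a ≤ L b ⊔ L c := by
    obtain ⟨α₀, hα₀, β₀, hβ₀, h⟩ := AddSubgroup.mem_sup.1 hcab
    have hα₀0 : α₀ ≠ 0 := by
      rintro rfl
      exact hcb (by simpa [← h] using hβ₀)
    rw [← hL.eq_of_mem hα₀ hα₀0]
    refine hb c α₀ ?_
    have := AddSubgroup.add_mem_sup (neg_mem hβ₀) (hL.self_mem c)
    convert this using 1
    rw [← h]
    abel
  have key : ∀ (δ : L d) (α α' : L a) (β : L b), (α' : V) - β ∈ L c →
      (μ δ (α + α') : V) - μ δ α - ν δ β ∈ L c := by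
    intro δ α α' β hβ
    have h1 : d + ((α + α' : L a) : V) ∈ L c ⊔ L (d + α + β) := by
      have := AddSubgroup.add_mem_sup hβ (hL.self_mem (d + α + β))
      convert this using 1
      push_cast
      abel
    obtain ⟨γ, hγ, y, hy, hxy⟩ := AddSubgroup.mem_sup.1 (hc _ _ h1 (hμ δ (α + α')))
    have hyeq := hunique α β y _ hy (hμν δ α β) (by
      have : y - (δ + μ δ α + ν δ β) = (μ δ (α + α') - μ δ α : V) + (-ν δ β) + -γ := by
        rw [eq_sub_of_add_eq' hxy]
        abel
      rw [this]
      exact add_mem (AddSubgroup.add_mem_sup ((L a).sub_mem (μ δ (α + α')).2 (μ δ α).2)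
        (neg_mem (ν δ β).2)) (neg_mem (hCle hγ)))
    convert hγ using 1
    rw [eq_sub_of_add_eq hxy, hyeq]
    abel
  intro δ α α'
  obtain ⟨β, hβ, γ, hγ, h⟩ := AddSubgroup.mem_sup.1 (hAle α'.2)
  have hβ' : (α' : V) - β ∈ L c := by
    rw [← h]
    simpa using hγ
  have h0 : μ δ 0 = 0 := ((hμiff δ 0 0).1 (by simp)).symm
  have h1 := (L c).sub_mem (key δ α α' ⟨β, hβ⟩ hβ') (key δ 0 α' ⟨β, hβ⟩ hβ')
  rw [zero_add, h0] at h1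
  have h2 : (μ δ (α + α') : V) - μ δ α - ν δ ⟨β, hβ⟩ - (μ δ α' - (0 : L a) - ν δ ⟨β, hβ⟩) =
      μ δ (α + α') - (μ δ α + μ δ α') := by
    push_cast
    abel
  rw [h2] at h1
  exact Subtype.ext (sub_eq_zero.1
    (hac _ ((L a).sub_mem (μ δ (α + α')).2 ((L a).add_mem (μ δ α).2 (μ δ α').2)) h1))

end shears

/-! ### Pseudo-planes in odd order -/

namespace IsCosetSpace

variable {P : Type*} [AddCommGroup P] {v k : ℕ} {T : SpernerSpace P v k} {L : P → AddSubgroup P}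

/-- The sum `x + y` is the midpoint of `x + x` and `y + y`, which lie in `L x` and `L y`. Odd order
keeps these two points distinct when `x ≠ y`, so they span a line containing the midpoint. -/
theorem exists_addSubgroup_of_isLineClosed [Finite P] (hT : IsCosetSpace T L) (hv : Odd v)
    {M : Set P} (hM : T.IsLineClosed M) (h0 : 0 ∈ M) :
    ∃ U : AddSubgroup P, M = U ∧ IsSaturated L U := by
  have hL := hT.spread
  have h2 : ∀ x : P, x ≠ 0 → x + x ≠ 0 := by
    intro x hx hxx
    have hcop : (Nat.card P).Coprime 2 := by
      rw [T.card_eq]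
      exact Nat.coprime_two_right.2 hv
    refine hx (hcop.nsmul_right_bijective.1 ?_)
    simpa [two_nsmul] using hxx
  have hsub := fun x (hx : x ∈ M) => hT.le_of_isLineClosed hM h0 hx
  refine ⟨⟨⟨⟨M, fun {x y} hx hy => ?_⟩, h0⟩, fun {x} hx => hsub x hx (neg_mem (hL.self_mem x))⟩,
    rfl, hsub⟩
  by_cases hxy : x = y
  · subst hxy
    exact hsub x hx (add_mem (hL.self_mem x) (hL.self_mem x))
  · have hd : y - x ≠ 0 := sub_ne_zero.2 (Ne.symm hxy)
    have hdd := h2 _ hd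
    have heq : (y + y) - (x + x) = (y - x) + (y - x) := by abel
    refine hM (x + x) (hsub x hx (add_mem (hL.self_mem x) (hL.self_mem x)))
      (y + y) (hsub y hy (add_mem (hL.self_mem y) (hL.self_mem y)))
      (fun h => hdd (by rw [← heq, h, sub_self])) _ (hT.coset_mem_lines hd (x + x))
      (by simp) ?_ ?_
    · show y + y - (x + x) ∈ L (y - x)
      rw [heq]
      exact add_mem (hL.self_mem _) (hL.self_mem _)
    · show x + y - (x + x) ∈ L (y - x)
      rw [show x + y - (x + x) = y - x by abel]
      exact hL.self_mem _

theorem exists_eq_sup_of_isPseudoPlane [Finite P] (hT : IsCosetSpace T L) (hodd : Odd v)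
    (hv : v = k ^ 3) {a b : P} (ha0 : a ≠ 0) (ha : IsNormalDirection L a) {E : Set P}
    (hE : T.IsPseudoPlane E) (haE : (L a : Set P) ⊆ E) (hbE : ¬ (L b : Set P) ⊆ E) :
    ∃ d, d ∉ L a ∧ E = ↑(L a ⊔ L d) := by
  have hL := hT.spread
  obtain ⟨x, y, z, hxyz, hE⟩ := hE
  have hcl : T.IsLineClosed E := hE ▸ T.isLineClosed_manifold _
  obtain ⟨U, rfl, hU⟩ := hT.exists_addSubgroup_of_isLineClosed hodd hcl (haE (L a).zero_mem)
  have hsub : ({x, y, z} : Set P) ⊆ U := hE ▸ T.subset_manifold _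
  have hne : ∃ d ∈ U, d ∉ L a := by
    by_contra h
    push Not at h
    exact hxyz ⟨_, hT.coe_mem_lines ha0, h x (hsub (by simp)), h y (hsub (by simp)),
      h z (hsub (by simp))⟩
  obtain ⟨d, hdU, hd⟩ := hne
  have hle : L a ⊔ L d ≤ U := sup_le haE (hU d hdU)
  refine ⟨d, hd, congrArg _ (le_antisymm (fun e heU => ?_) hle)⟩
  by_contra he
  refine hbE fun y _ => ?_
  -- A third independent member would exhaust all `k ^ 3` points, and the pseudo-plane would contain
  -- `L b`.
  have htop : L a ⊔ L d ⊔ L e = ⊤ := by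
    refine AddSubgroup.eq_top_of_card_eq _ ?_
    rw [hL.card_sup (ha d) he, hL.card_sup (hL.isSaturated _) hd, hL.card _ ha0, T.card_eq, hv]
    ring
  exact (htop.ge.trans (sup_le hle (hU e heU))) (AddSubgroup.mem_top y)

theorem isAffineSemifieldPlane_of_isPseudoPlane [Finite P] (hT : IsCosetSpace T L) (hodd : Odd v)
    (hv : v = k ^ 3) {N : Set (Set P)} (hcard : N.ncard = 3) (hN : T.AreNormalLinesThrough 0 N)
    (hplane : ∃ E : Set P, T.IsAffinePlane E ∧ ∀ l ∈ N, l ⊆ E) {E : Set P}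
    (hE : T.IsPseudoPlane E) (huniq : ∃! l, l ∈ N ∧ l ⊆ E) : T.IsAffineSemifieldPlane E := by
  have hL := hT.spread
  obtain ⟨w, hw, rfl⟩ := hT.exists_directions hcard hN
  obtain ⟨_, ⟨⟨i, rfl⟩, haE⟩, hu⟩ := huniq
  have hnot : ∀ j, j ≠ i → ¬ (L (w j) : Set P) ⊆ E := by
    intro j hj hjE
    have h := hu _ ⟨⟨j, rfl⟩, hjE⟩
    have h1 : w j ∈ (L (w j) : Set P) := hL.self_mem _
    rw [show (L (w j) : Set P) = L (w i) from h] at h1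
    exact hw.notMem j i hj h1
  obtain ⟨j, m, hji, hmi, hmj⟩ : ∃ j m : Fin 3, j ≠ i ∧ m ≠ i ∧ m ≠ j :=
    (by decide : ∀ i : Fin 3, ∃ j m : Fin 3, j ≠ i ∧ m ≠ i ∧ m ≠ j) i
  obtain ⟨d, hd, rfl⟩ := hT.exists_eq_sup_of_isPseudoPlane hodd hv (hw.ne_zero i) (hw.isNormal i)
    hE haE (hnot j hji)
  obtain ⟨M, hM, hMN⟩ := hplane
  obtain ⟨U, rfl, hU, hUcard⟩ := hT.exists_addSubgroup_of_isAffinePlane hM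
    (hMN _ ⟨i, rfl⟩ (L (w i)).zero_mem) (hN _ ⟨i, rfl⟩).1.1 (hMN _ ⟨i, rfl⟩)
  have hUeq : L (w i) ⊔ L (w j) = U := by
    refine AddSubgroup.eq_of_le_of_card_ge (sup_le (hMN _ ⟨i, rfl⟩) (hMN _ ⟨j, rfl⟩)) ?_
    rw [hUcard, hL.card_sup (hL.isSaturated _) (hw.notMem j i hji), hL.card _ (hw.ne_zero i), sq]
  have hcab : w m ∈ L (w i) ⊔ L (w j) := hUeq ▸ hMN _ ⟨m, rfl⟩ (hL.self_mem _)
  -- Otherwise the pseudo-plane would be the common plane, by counting, and would contain a second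
  -- of the three lines.
  have hdab : d ∉ L (w i) ⊔ L (w j) := by
    intro hdab
    have hle : L (w i) ⊔ L d ≤ L (w i) ⊔ L (w j) := sup_le le_sup_left (hw.isNormal i _ _ hdab)
    have heq : L (w i) ⊔ L d = L (w i) ⊔ L (w j) := by
      refine AddSubgroup.eq_of_le_of_card_ge hle ?_
      rw [hL.card_sup (hL.isSaturated _) (hw.notMem j i hji), hL.card_sup (hL.isSaturated _) hd]
    exact hnot j hji (heq ▸ SetLike.coe_subset_coe.2 le_sup_right)
  obtain ⟨μ, hμ, hadd⟩ := hL.exists_additive (hw.isNormal i) (hw.isNormal j) (hw.isNormal m) hcab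
    (hw.notMem j i hji) (hw.notMem m i hmi) (hw.notMem m j hmj) hdab
  refine hT.isAffineSemifieldPlane (hw.ne_zero i) (hw.isNormal i) hd hμ hadd ?_
  rw [← hw.manifold_insert i d hd]
  exact (hN _ ⟨i, rfl⟩).1.2 d hd

end IsCosetSpace

/-! ### The main theorem -/

theorem mainTheorem10 {P : Type*} (q r n : ℕ) (hq : IsPrimePow q) (hn : 0 < n) (hr : 2 < r)
    (T : SpernerSpace P (q ^ (r * n)) (q ^ n)) (hT : T.IsTranslation) :
    (∀ (p : P) (N : Set (Set P)), N.ncard = r + 1 → T.AreNormalLinesThrough p N →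
      T.InGeneralPosition r p N → T.IsIsomorphicToAG r (q ^ n)) ∧
    (r = 3 → Odd q →
      (∀ (p : P) (N : Set (Set P)), N.ncard = 3 → T.AreNormalLinesThrough p N →
        (∃ E : Set P, T.IsAffinePlane E ∧ ∀ l ∈ N, l ⊆ E) →
        ∀ E : Set P, T.IsPseudoPlane E → (∃! l, l ∈ N ∧ l ⊆ E) → T.IsAffineSemifieldPlane E) ∧
      (∀ (p : P) (N : Set (Set P)), N.ncard = 4 → T.AreNormalLinesThrough p N →
        (¬ ∃ E : Set P, T.IsAffinePlane E ∧ ∀ l ∈ N, l ⊆ E) →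
        T.IsIsomorphicToAG 3 (q ^ n))) ∧
    (Odd q → ∀ (p : P) (N : Set (Set P)), N.Finite → r + 1 ≤ N.ncard →
      T.AreNormalLinesThrough p N →
      (∃ N' ⊆ N, N'.ncard = r ∧ T.manifold (⋃₀ N') = Set.univ) →
      T.IsIsomorphicToAG r (q ^ n)) := by
  have hk : 1 < q ^ n := Nat.one_lt_pow hn.ne' hq.one_lt
  have hv : q ^ (r * n) = (q ^ n) ^ r := by rw [mul_comm, pow_mul]
  have : Finite P := Set.finite_univ_iff.1 T.isDesign.1
  have hcoset := fun p => hT.exists_isCosetSpace hk p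
  refine ⟨fun p N hcard hN hgen => ?_, fun h3 hodd => ⟨fun p N hcard hN hplane E hE huniq => ?_,
    fun p N hcard hN hplane => ?_⟩, fun _ p N _ hcard hN hN' => ?_⟩
  · obtain ⟨_, L, hL, rfl⟩ := hcoset p
    exact hL.isIsomorphicToAG_of_inGeneralPosition hr hv hcard hN hgen
  · obtain ⟨_, L, hL, rfl⟩ := hcoset p
    exact hL.isAffineSemifieldPlane_of_isPseudoPlane hodd.pow (hv.trans (by rw [h3])) hcard hN
      hplane hE huniq
  · obtain ⟨_, L, hL, rfl⟩ := hcoset p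
    exact hL.isIsomorphicToAG_of_not_coplanar (hv.trans (by rw [h3])) hcard hN hplane
  · obtain ⟨_, L, hL, rfl⟩ := hcoset p
    obtain ⟨N', hsub, hcard', huniv⟩ := hN'
    exact hL.isIsomorphicToAG_of_manifold_eq_univ hr hv hcard hN hsub hcard' huniv
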